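/- Let $G=\mathrm{PSL}_2(\mathbb C)$ act on $\mathbb P^1=\mathbb P(\mathbb C^2)$ by Möbius transformations, and let $L^2_{(1,0)}$ be the space of $(1,0)$-forms $\phi$ on $\mathbb P^1$ with $L^2$ coefficients (modulo equality almost everywhere), with the norm $\|\phi\|_{L^2}=\big(\int_{\mathbb P^1} i\,\phi\wedge\overline\phi\big)^{1/2}$. For a Borel probability measure $\mu$ on $G$ and $n\ge 1$, let $\mu^{*n}$ be the $n$-fold convolution power of $\mu$, i.e. the law of $g_n\cdots g_1$ with $g_1,\dots,g_n$ independent of law $\mu$, and let $(f_\mu^n)^*:L^2_{(1,0)}\to L^2_{(1,0)}$ be the bounded linear operator $$(f_\mu^n)^*\phi=\int_G g^*\phi\ \mathrm d\mu^{*n}(g),$$ where the integral converges absolutely at almost every point of $\mathbb P^1$. A subset $R\subset G$ is called elementary if either $R$ is conjugate to a subset of $\mathrm{PSU}(2)$, or there is a non-empty finite subset of $\mathbb P^1$ that is invariant by every element of $R$. The measure $\mu$ is called non-elementary if its support is not elementary. **Proposition.** Let $\mu$ be a non-elementary Borel probability measure on $\mathrm{PSL}_2(\mathbb C)$. Then there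 exists an integer $N\ge 1$ such that the operator norm of $(f_\mu^N)^*:L^2_{(1,0)}\to L^2_{(1,0)}$ is strictly less than $1$. -/

import Mathlib

open MeasureTheory
open scoped MatrixGroups LinearAlgebra.Projectivization ENNReal Matrix

noncomputable section

/-! ### Elementary subsets of `PSL₂(ℂ)` -/

/-- `PSU(2)`, the image of `SU(2)` in `PSL₂(ℂ)`. -/
def PSU2 : Set PSL(2, ℂ) :=
  {g | ∃ A : SL(2, ℂ), (A : Matrix (Fin 2) (Fin 2) ℂ) ∈ Matrix.unitaryGroup (Fin 2) ℂ ∧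
    QuotientGroup.mk A = g}

/-- `R ⊆ PSL₂(ℂ)` is elementary if it is conjugate to a subset of `PSU(2)`, or if some finite
(non-empty) subset of `ℙ¹ = ℙ(ℂ²)` is invariant by every element of `R`. -/
def IsElementary (R : Set PSL(2, ℂ)) : Prop :=
  (∃ h : PSL(2, ℂ), ∀ g ∈ R, h * g * h⁻¹ ∈ PSU2) ∨
  ∃ F : Set (ℙ ℂ (Fin 2 → ℂ)), F.Finite ∧ F.Nonempty ∧ ∀ g ∈ R, (fun p => g • p) '' F = F

/-- The convolution power `μ^{*n} = μ * ⋯ * μ`, i.e. the law of `g_n ⋯ g_1` where the `g_i` are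
independent of law `μ`. -/
def convPow [MeasurableSpace PSL(2, ℂ)] (μ : Measure PSL(2, ℂ)) : ℕ → Measure PSL(2, ℂ)
  | 0 => Measure.dirac 1
  | n + 1 => Measure.mconv μ (convPow μ n)

/-! ### (1,0)-forms on the projective line -/

/-- A (not necessarily continuous) form `φ` of type `(1,0)` on `ℙ¹` is encoded by its pull-back
`Φ = π^*φ` under the projection `π : ℂ² ∖ {0} → ℙ¹`. This identifies the `(1,0)`-forms on `ℙ¹`
with the fields `v ↦ Φ v` of `ℂ`-linear forms on `ℂ² = T_v(ℂ² ∖ {0})` that vanish on the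
tangent direction `ℂ v` of the fibre and are invariant by the dilations of `ℂ²`.
(The invariance forces `Φ 0 = 0`, so that the point `v = 0` carries no information.) -/
def oneFormSubmodule : Submodule ℂ ((Fin 2 → ℂ) → ((Fin 2 → ℂ) →L[ℂ] ℂ)) where
  carrier := {Φ | (∀ v, Φ v v = 0) ∧ ∀ c : ℂ, c ≠ 0 → ∀ v w, Φ (c • v) (c • w) = Φ v w}
  add_mem' := by
    rintro Φ Ψ ⟨h1, h2⟩ ⟨h3, h4⟩
    refine ⟨fun v => by simp [h1, h3], fun c hc v w => ?_⟩
    simp only [Pi.add_apply, add_apply, h2 c hc, h4 c hc]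
  zero_mem' := by simp
  smul_mem' := by
    rintro a Φ ⟨h1, h2⟩
    refine ⟨fun v => by simp [h1], fun c hc v w => ?_⟩
    simp only [Pi.smul_apply, smul_apply, h2 c hc]

/-- The complex vector space of `(1,0)`-forms on `ℙ¹` (see `oneFormSubmodule`). -/
def OneForm : Type := ↥oneFormSubmodule

namespace OneForm

instance : AddCommGroup OneForm := inferInstanceAs (AddCommGroup ↥oneFormSubmodule)

instance : Module ℂ OneForm := inferInstanceAs (Module ℂ ↥oneFormSubmodule)

/-- The linear form `Φ v` on `ℂ² = T_v(ℂ² ∖ {0})`. -/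
def form (Φ : OneForm) (v : Fin 2 → ℂ) : (Fin 2 → ℂ) →L[ℂ] ℂ := Φ.1 v

/-- The coefficient `u` of a form `φ = u dz` in the affine coordinate `z ↦ [z : 1]` of `ℙ¹`:
the value at the point `(z, 1)` on the tangent vector `(1, 0) = d/dz (z, 1)`. -/
def coeff (Φ : OneForm) (z : ℂ) : ℂ := Φ.form ![z, 1] ![1, 0]

/-- The pull-back of a form by a matrix `A ∈ SL₂(ℂ)`, `(A^*Φ)_v (w) = Φ_{A v} (A w)`. -/
def pullbackSL (A : SL(2, ℂ)) (Φ : OneForm) : OneForm :=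
  ⟨fun v => (Φ.form ((A : Matrix (Fin 2) (Fin 2) ℂ) *ᵥ v)).comp
      (LinearMap.toContinuousLinearMap (Matrix.mulVecLin (A : Matrix (Fin 2) (Fin 2) ℂ))), by
    refine ⟨fun v => ?_, fun c hc v w => ?_⟩
    · simpa using! Φ.2.1 ((A : Matrix (Fin 2) (Fin 2) ℂ) *ᵥ v)
    · have h := Φ.2.2 c hc ((A : Matrix (Fin 2) (Fin 2) ℂ) *ᵥ v)
        ((A : Matrix (Fin 2) (Fin 2) ℂ) *ᵥ w)
      rw [← Matrix.mulVec_smul, ← Matrix.mulVec_smul] at h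
      exact h⟩

/-- The pull-back by a matrix only depends on its class in `PSL₂(ℂ)`. -/
theorem pullbackSL_congr (Φ : OneForm) (A B : SL(2, ℂ))
    (h : A⁻¹ * B ∈ Subgroup.center SL(2, ℂ)) : pullbackSL A Φ = pullbackSL B Φ := by
  obtain ⟨r, hr, hC⟩ := Matrix.SpecialLinearGroup.mem_center_iff.1 h
  have hr0 : r ≠ 0 := by
    rintro rfl
    simp at hr
  have hB : (B : Matrix (Fin 2) (Fin 2) ℂ) = r • (A : Matrix (Fin 2) (Fin 2) ℂ) := by
    have h1 : B = A * (A⁻¹ * B) := by group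
    have h2 : (B : Matrix (Fin 2) (Fin 2) ℂ)
        = (A : Matrix (Fin 2) (Fin 2) ℂ) * ((A⁻¹ * B : SL(2, ℂ)) : Matrix (Fin 2) (Fin 2) ℂ) := by
      rw [← Matrix.SpecialLinearGroup.coe_mul, ← h1]
    rw [h2, ← hC, Matrix.scalar_apply, ← Matrix.smul_one_eq_diagonal, Matrix.mul_smul, mul_one]
  refine Subtype.ext (funext fun v => ContinuousLinearMap.ext fun w => ?_)
  have key := Φ.2.2 r hr0 ((A : Matrix (Fin 2) (Fin 2) ℂ) *ᵥ v)
    ((A : Matrix (Fin 2) (Fin 2) ℂ) *ᵥ w)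
  simp only [pullbackSL, form, ContinuousLinearMap.comp_apply,
    LinearMap.coe_toContinuousLinearMap', Matrix.mulVecLin_apply, hB, Matrix.smul_mulVec]
  exact key.symm

/-- The pull-back `g^*φ` of a form by `g ∈ PSL₂(ℂ) = Aut(ℙ¹)`. -/
def pullback (g : PSL(2, ℂ)) (Φ : OneForm) : OneForm :=
  Quotient.liftOn' g (fun A => pullbackSL A Φ) fun A B h =>
    pullbackSL_congr Φ A B (QuotientGroup.leftRel_apply.1 h)

/-- `f_μ^* φ = ∫ g^*φ dμ(g)`, computed pointwise (the value is `0` at the points where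
`g ↦ g^*φ` is not `μ`-integrable). -/
def transfer [MeasurableSpace PSL(2, ℂ)] (μ : Measure PSL(2, ℂ)) (Φ : OneForm) : OneForm :=
  ⟨fun v => ∫ g, (pullback g Φ).form v ∂μ, by
    refine ⟨fun v => ?_, fun c hc v w => ?_⟩
    · by_cases hi : Integrable (fun g => (pullback g Φ).form v) μ
      · rw [ContinuousLinearMap.integral_apply hi]
        have : ∀ g, (pullback g Φ).form v v = 0 := fun g => (pullback g Φ).2.1 v
        simp [this]
      · simp only [integral_undef hi]
        rfl
    · have h : ∀ g, (pullback g Φ).form (c • v) = c⁻¹ • (pullback g Φ).form v := by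
        intro g
        ext1 x
        have h1 : (pullback g Φ).form (c • v) (c • (c⁻¹ • x)) = (pullback g Φ).form v (c⁻¹ • x) :=
          (pullback g Φ).2.2 c hc v (c⁻¹ • x)
        rw [smul_inv_smul₀ hc] at h1
        rw [h1, map_smul, smul_apply]
      simp only [h, integral_smul]
      rw [smul_apply, map_smul, inv_smul_smul₀ hc]⟩

end OneForm

/-! ### The Hilbert space of square integrable (1,0)-forms -/

/-- The measure on `ℂ` given by the area form `i dz ∧ dz̄ = 2 dx ∧ dy`. -/
def areaMeasure : Measure ℂ := (2 : ℝ≥0∞) • volume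

/-- `φ` has `L²` coefficients. If `φ = u dz` in the affine coordinate `z`, which misses only one
point of `ℙ¹`, then `∫_{ℙ¹} i φ ∧ φ̄ = ∫_ℂ |u|² i dz ∧ dz̄`. -/
def OneForm.MemL2 (Φ : OneForm) : Prop := MemLp Φ.coeff 2 areaMeasure

/-- The space of `(1,0)`-forms with `L²` coefficients, before identifying forms that agree almost
everywhere. -/
def l2FormSubmodule : Submodule ℂ OneForm where
  carrier := {Φ | Φ.MemL2}
  add_mem' := fun h1 h2 => MemLp.add h1 h2
  zero_mem' := MemLp.zero' (μ := areaMeasure) (p := 2) (ε := ℂ)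
  smul_mem' := fun a _ h => MemLp.const_smul h a

/-- See `l2FormSubmodule`. -/
def PreL2Form : Type := ↥l2FormSubmodule

namespace PreL2Form

instance : AddCommGroup PreL2Form := inferInstanceAs (AddCommGroup ↥l2FormSubmodule)

instance : Module ℂ PreL2Form := inferInstanceAs (Module ℂ ↥l2FormSubmodule)

/-- The linear map sending `φ = u dz` to the class of `u` in `L²(ℂ, i dz ∧ dz̄)`. -/
def coeffLp : PreL2Form →ₗ[ℂ] Lp ℂ 2 areaMeasure where
  toFun Φ := MemLp.toLp (OneForm.coeff Φ.1) Φ.2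
  map_add' Φ Ψ := MemLp.toLp_add Φ.2 Ψ.2
  map_smul' a Φ := MemLp.toLp_const_smul a Φ.2

/-- The seminorm `‖φ‖ = (∫_{ℙ¹} i φ ∧ φ̄)^{1/2}`. -/
instance : SeminormedAddCommGroup PreL2Form :=
  SeminormedAddCommGroup.induced PreL2Form (Lp ℂ 2 areaMeasure) coeffLp

instance : NormedSpace ℂ PreL2Form := NormedSpace.induced ℂ PreL2Form (Lp ℂ 2 areaMeasure) coeffLp

end PreL2Form

/-- The normed space `L²_{(1,0)}` of `(1,0)`-forms on `ℙ¹` with `L²` coefficients, modulo equality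
almost everywhere, with the norm `‖φ‖ = (∫_{ℙ¹} i φ ∧ φ̄)^{1/2}`. -/
abbrev L2Form : Type := SeparationQuotient PreL2Form

/-- The class in `L²_{(1,0)}` of a form with `L²` coefficients. -/
def L2Form.mk (Φ : OneForm) (h : Φ.MemL2) : L2Form :=
  SeparationQuotient.mk (⟨Φ, h⟩ : PreL2Form)

/-- `T` is the operator `f_μ^* : L²_{(1,0)} → L²_{(1,0)}`: for every form `φ` with `L²`
coefficients, the integral `∫ g^*φ dμ(g)` converges absolutely at almost every point of `ℙ¹`, and
it defines a form with `L²` coefficients whose class is the image by `T` of the class of `φ`. -/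
def IsTransferOperator [MeasurableSpace PSL(2, ℂ)] (μ : Measure PSL(2, ℂ))
    (T : L2Form →L[ℂ] L2Form) : Prop :=
  ∀ (Φ : OneForm) (hΦ : Φ.MemL2),
    (∀ᵐ z : ℂ, Integrable (fun g => (Φ.pullback g).form ![z, 1]) μ) ∧
    ∃ h : (Φ.transfer μ).MemL2, T (L2Form.mk Φ hΦ) = L2Form.mk (Φ.transfer μ) h

end

/-!
Each `g^*` preserves the `L²` norm, and the bias-variance decomposition of `g ↦ g^*φ` reads
`∫ ‖g^*φ - f_μ^*φ‖² dμ(g) + ‖f_μ^*φ‖² = ‖φ‖²`. If every power of `f_μ^*` has norm one, there are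
unit forms `φ_n` for which `‖(f_μ^*)^(n + 1) φ_n‖` tends to one quickly. Put
`φ_(n,N) = (f_μ^*)^N φ_n`. By the decomposition, `g^* φ_(n,N) - φ_(n,N+1)` tends to zero as `n → ∞`
for every `N` and `μ`-almost every `g`. Weak limits `M_N` of the measures `i φ_(n,N) ∧ φ̄_(n,N)` are
then probability measures on the projective line with `g_* M_(N+1) = M_N` for these `g`.

So `g h⁻¹` lies in the group `H` of the elements preserving every `M_N`, and `g` normalises `H`. If
`H` is bounded, it preserves a positive definite Hermitian form `P`: either all `g` preserve `P`, or
some translate of `P` by a `g` is a second invariant form and the eigenlines of `P⁻¹ (g^* P)` are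
fixed by `H`. If `H` is unbounded, it contracts the complement of a point to a point, so that `M_0`
is carried by two points and has an atom, whose `H`-orbit is finite. In each case the supporting set
of `g` is elementary, and this passes to the closure.
-/

noncomputable section

/-! ### Determinants of pairs of vectors and the projective line -/

section Wedge

/-- The determinant `v ∧ w` of two vectors of the plane, which detects whether they span the same
point of the projective line. -/
def wedge {R : Type*} [CommRing R] (v w : Fin 2 → R) : R := v 0 * w 1 - v 1 * w 0

variable {R : Type*} [CommRing R]

theorem wedge_smul_left (c : R) (v w : Fin 2 → R) : wedge (c • v) w = c * wedge v w := by
  simp only [wedge, Pi.smul_apply, smul_eq_mul]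
  ring

theorem wedge_smul_right (c : R) (v w : Fin 2 → R) : wedge v (c • w) = c * wedge v w := by
  simp only [wedge, Pi.smul_apply, smul_eq_mul]
  ring

theorem wedge_self (v : Fin 2 → R) : wedge v v = 0 := by
  rw [wedge, mul_comm, sub_self]

theorem wedge_swap (v w : Fin 2 → R) : wedge w v = -wedge v w := by
  simp only [wedge]
  ring

theorem wedge_smul_eq_add (u v w : Fin 2 → R) :
    wedge u w • v = wedge v w • u + wedge u v • w := by
  ext i
  fin_cases i <;>
  · simp [wedge]
    ring

theorem wedge_mulVec (A : SL(2, R)) (v w : Fin 2 → R) :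
    wedge (A.1 *ᵥ v) (A.1 *ᵥ w) = wedge v w := by
  have hdet := A.2
  rw [Matrix.det_fin_two] at hdet
  simp only [wedge, Matrix.mulVec, dotProduct, Fin.sum_univ_two]
  linear_combination (v 0 * w 1 - v 1 * w 0) * hdet

/-- The quadratic form `y ↦ A y ∧ y` is determined by its values on three lines. -/
theorem wedge_mulVec_self_interpolation (A : Matrix (Fin 2) (Fin 2) R) (u v w y : Fin 2 → R) :
    wedge u v * wedge u w * wedge v w * wedge (A *ᵥ y) y =
      wedge v w * wedge v y * wedge w y * wedge (A *ᵥ u) u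
        - wedge u w * wedge u y * wedge w y * wedge (A *ᵥ v) v
        + wedge u v * wedge u y * wedge v y * wedge (A *ᵥ w) w := by
  simp only [wedge, Matrix.mulVec, dotProduct, Fin.sum_univ_two]
  ring

theorem continuous_wedge [TopologicalSpace R] [IsTopologicalRing R] :
    Continuous fun x : (Fin 2 → R) × (Fin 2 → R) => wedge x.1 x.2 := by
  unfold wedge
  fun_prop

variable {K : Type*} [Field K]

theorem exists_wedge_eq_one {w : Fin 2 → K} (hw : w ≠ 0) : ∃ x, wedge x w = 1 := by
  by_cases h1 : w 1 = 0
  · have h0 : w 0 ≠ 0 := fun h0 => hw (by ext i; fin_cases i <;> simp [h0, h1])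
    exact ⟨![0, -(w 0)⁻¹], by simp [wedge, h0]⟩
  · exact ⟨![(w 1)⁻¹, 0], by simp [wedge, h1]⟩

theorem mk_eq_mk_iff_wedge {v w : Fin 2 → K} (hv : v ≠ 0) (hw : w ≠ 0) :
    Projectivization.mk K v hv = Projectivization.mk K w hw ↔ wedge v w = 0 := by
  rw [Projectivization.mk_eq_mk_iff']
  constructor
  · rintro ⟨a, rfl⟩
    rw [wedge_smul_left, wedge_self, mul_zero]
  · intro h
    obtain ⟨x, hx⟩ := exists_wedge_eq_one hw
    have hplucker := wedge_smul_eq_add x v w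
    rw [hx, h, one_smul, zero_smul, zero_add] at hplucker
    exact ⟨wedge x v, hplucker.symm⟩

theorem mulVec_ne_zero (A : SL(2, K)) {v : Fin 2 → K} (hv : v ≠ 0) : A.1 *ᵥ v ≠ 0 := by
  obtain ⟨x, hx⟩ := exists_wedge_eq_one hv
  intro h
  rw [← wedge_mulVec A, h] at hx
  simp [wedge] at hx

theorem mk_smul_mk (A : SL(2, K)) {v : Fin 2 → K} (hv : v ≠ 0) :
    (QuotientGroup.mk A : PSL(2, K)) • Projectivization.mk K v hv =
      Projectivization.mk K (A.1 *ᵥ v) (mulVec_ne_zero A hv) :=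
  rfl

theorem mk_smul_mk_eq_mk_iff (A : SL(2, K)) {v w : Fin 2 → K} (hv : v ≠ 0) (hw : w ≠ 0) :
    (QuotientGroup.mk A : PSL(2, K)) • Projectivization.mk K v hv = Projectivization.mk K w hw ↔
      wedge (A.1 *ᵥ v) w = 0 :=
  mk_eq_mk_iff_wedge (mulVec_ne_zero A hv) hw

theorem eq_one_of_smul_eq_of_ne {g : PSL(2, K)} {p q r : ℙ K (Fin 2 → K)} (hpq : p ≠ q)
    (hpr : p ≠ r) (hqr : q ≠ r) (hp : g • p = p) (hq : g • q = q) (hr : g • r = r) : g = 1 := by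
  refine eq_of_smul_eq_smul (α := ℙ K (Fin 2 → K)) fun y => ?_
  induction g using QuotientGroup.induction_on with | H A
  induction p using Projectivization.ind with | h u hu
  induction q using Projectivization.ind with | h v hv
  induction r using Projectivization.ind with | h w hw
  induction y using Projectivization.ind with | h y hy
  rw [mk_smul_mk_eq_mk_iff] at hp hq hr
  rw [Ne, mk_eq_mk_iff_wedge] at hpq hpr hqr
  rw [one_smul, mk_smul_mk_eq_mk_iff]
  have hquad := wedge_mulVec_self_interpolation A.1 u v w y
  rw [hp, hq, hr] at hquad
  simpa [hpq, hpr, hqr] using hquad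

theorem exists_smul_eq_self [IsAlgClosed K] (g : PSL(2, K)) : ∃ p : ℙ K (Fin 2 → K), g • p = p := by
  induction g using QuotientGroup.induction_on with | H A
  obtain ⟨c, hc⟩ := Module.End.exists_eigenvalue (Matrix.toLin' A.1)
  obtain ⟨v, hv⟩ := hc.exists_hasEigenvector
  refine ⟨Projectivization.mk K v hv.2, ?_⟩
  rw [mk_smul_mk_eq_mk_iff, ← Matrix.toLin'_apply, hv.apply_eq_smul, wedge_smul_left, wedge_self,
    mul_zero]

theorem mk_eq_mk_iff_eq_or_eq_neg {A B : SL(2, K)} :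
    (QuotientGroup.mk A : PSL(2, K)) = QuotientGroup.mk B ↔ B = A ∨ B = -A := by
  rw [QuotientGroup.eq, Matrix.SpecialLinearGroup.mem_center_iff]
  constructor
  · rintro ⟨r, hr, hAB⟩
    have hB : B.1 = r • A.1 := by
      rw [← mul_inv_cancel_left A B, Matrix.SpecialLinearGroup.coe_mul, ← hAB, Matrix.scalar_apply,
        ← Matrix.smul_one_eq_diagonal, Matrix.mul_smul, mul_one]
    rw [Fintype.card_fin] at hr
    exact (sq_eq_one_iff.1 hr).imp (fun h => Subtype.ext (by simp [hB, h]))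
      fun h => Subtype.ext (by simp [hB, h])
  · rintro (rfl | rfl)
    · exact ⟨1, by simp, by simp⟩
    · exact ⟨-1, by simp, by ext i j; simp [Matrix.one_apply, Matrix.diagonal_apply, neg_ite]⟩

end Wedge

/-! ### Elementary sets -/

theorem isClosed_iff_isClosed_preimage_mk {s : Set PSL(2, ℂ)} :
    IsClosed s ↔ IsClosed ((QuotientGroup.mk : SL(2, ℂ) → PSL(2, ℂ)) ⁻¹' s) :=
  ((QuotientGroup.isQuotientMap_mk _).isClosed_preimage).symm

theorem mk_mem_PSU2_iff (A : SL(2, ℂ)) :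
    (QuotientGroup.mk A : PSL(2, ℂ)) ∈ PSU2 ↔ A.1 * A.1ᴴ = 1 := by
  rw [← Matrix.star_eq_conjTranspose, ← Matrix.mem_unitaryGroup_iff]
  refine ⟨?_, fun h => ⟨A, h, rfl⟩⟩
  rintro ⟨B, hB, hBA⟩
  rcases mk_eq_mk_iff_eq_or_eq_neg.1 hBA with rfl | rfl
  · exact hB
  · simpa [Matrix.mem_unitaryGroup_iff] using hB

theorem isClosed_PSU2 : IsClosed PSU2 := by
  rw [isClosed_iff_isClosed_preimage_mk]
  simp only [Set.preimage, mk_mem_PSU2_iff]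
  exact isClosed_eq (continuous_subtype_val.mul continuous_subtype_val.matrix_conjTranspose)
    continuous_const

theorem isClosed_setOf_smul_eq (p q : ℙ ℂ (Fin 2 → ℂ)) : IsClosed {g : PSL(2, ℂ) | g • p = q} := by
  induction p using Projectivization.ind with | h v hv
  induction q using Projectivization.ind with | h w hw
  rw [isClosed_iff_isClosed_preimage_mk]
  simp only [Set.preimage_ofPred_eq, mk_smul_mk_eq_mk_iff]
  exact isClosed_eq (continuous_wedge.comp
    ((continuous_subtype_val.matrix_mulVec continuous_const).prodMk continuous_const))
    continuous_const

theorem IsElementary.of_finite {S : Set PSL(2, ℂ)} {F : Set (ℙ ℂ (Fin 2 → ℂ))} (hF : F.Finite)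
    (hne : F.Nonempty) (h : ∀ g ∈ S, ∀ p ∈ F, g⁻¹ • p ∈ F) : IsElementary S :=
  Or.inr ⟨F, hF, hne, fun g hg => (MulAction.mem_stabilizer_set_iff_subset_smul_set hF).2
    fun p hp => ⟨g⁻¹ • p, h g hg p hp, smul_inv_smul g p⟩⟩

theorem IsElementary.of_subset_closure {S T : Set PSL(2, ℂ)} (hS : IsElementary S)
    (hT : T ⊆ closure S) : IsElementary T := by
  rcases hS with ⟨h, hh⟩ | ⟨F, hF, hne, hinv⟩
  · have hcl : IsClosed {g : PSL(2, ℂ) | h * g * h⁻¹ ∈ PSU2} :=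
      isClosed_PSU2.preimage (by fun_prop)
    exact Or.inl ⟨h, fun g hg => closure_minimal hh hcl (hT hg)⟩
  · refine IsElementary.of_finite hF hne fun g hg p hp => ?_
    have hcl : IsClosed (⋃ q ∈ F, {g : PSL(2, ℂ) | g • q = p}) :=
      hF.isClosed_biUnion fun q _ => isClosed_setOf_smul_eq q p
    have hS : S ⊆ ⋃ q ∈ F, {g : PSL(2, ℂ) | g • q = p} := fun g hg => by
      obtain ⟨q, hq, hqp⟩ := (hinv g hg).ge hp
      exact Set.mem_biUnion hq hqp
    obtain ⟨q, hq, rfl⟩ : ∃ q ∈ F, g • q = p := by simpa using closure_minimal hS hcl (hT hg)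
    rwa [inv_smul_smul]

/-! ### The metric of the projective line -/

section ProjectiveMetric

variable {𝕜 : Type*} [NormedField 𝕜]

/-- The distance `|v ∧ w| / (‖v‖ ‖w‖)` of the lines spanned by `v` and `w`, where `‖·‖` is the sup
norm: only the topology of the projective line matters here. -/
instance : Dist (ℙ 𝕜 (Fin 2 → 𝕜)) := ⟨fun p q => ‖wedge p.rep q.rep‖ / (‖p.rep‖ * ‖q.rep‖)⟩

theorem dist_mk_mk {v w : Fin 2 → 𝕜} (hv : v ≠ 0) (hw : w ≠ 0) :
    dist (Projectivization.mk 𝕜 v hv) (Projectivization.mk 𝕜 w hw) =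
      ‖wedge v w‖ / (‖v‖ * ‖w‖) := by
  obtain ⟨a, ha⟩ := Projectivization.exists_smul_eq_mk_rep 𝕜 v hv
  obtain ⟨b, hb⟩ := Projectivization.exists_smul_eq_mk_rep 𝕜 w hw
  have hab : ‖(a : 𝕜)‖ * ‖(b : 𝕜)‖ ≠ 0 := by simp
  change ‖wedge _ _‖ / _ = _
  simp only [← ha, ← hb, Units.smul_def, wedge_smul_left, wedge_smul_right, norm_smul, norm_mul]
  rw [← mul_assoc, mul_mul_mul_comm, mul_comm ‖(b : 𝕜)‖, mul_div_mul_left _ _ hab]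

/-- The triangle inequality is the Plücker relation `wedge_smul_eq_add`. -/
instance : MetricSpace (ℙ 𝕜 (Fin 2 → 𝕜)) where
  dist_self p := by
    induction p using Projectivization.ind with | h v hv
    simp [dist_mk_mk, wedge_self]
  dist_comm p q := by
    induction p using Projectivization.ind with | h v hv
    induction q using Projectivization.ind with | h w hw
    rw [dist_mk_mk, dist_mk_mk, wedge_swap, norm_neg, mul_comm]
  dist_triangle p q r := by
    induction p using Projectivization.ind with | h u hu
    induction q using Projectivization.ind with | h v hv
    induction r using Projectivization.ind with | h w hw
    have hnorm : ‖wedge u w‖ * ‖v‖ ≤ ‖wedge v w‖ * ‖u‖ + ‖wedge u v‖ * ‖w‖ := by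
      simpa only [← norm_smul, wedge_smul_eq_add u v w] using norm_add_le _ _
    rw [dist_mk_mk, dist_mk_mk, dist_mk_mk, div_add_div _ _ (by positivity) (by positivity),
      div_le_div_iff₀ (by positivity) (by positivity)]
    linear_combination ‖u‖ * ‖v‖ * ‖w‖ * hnorm
  eq_of_dist_eq_zero {p q} h := by
    induction p using Projectivization.ind with | h v hv
    induction q using Projectivization.ind with | h w hw
    simpa [dist_mk_mk, hv, hw, mk_eq_mk_iff_wedge] using h

theorem norm_wedge_le (v w : Fin 2 → 𝕜) : ‖wedge v w‖ ≤ 2 * (‖v‖ * ‖w‖) := by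
  calc ‖wedge v w‖ ≤ ‖v 0‖ * ‖w 1‖ + ‖v 1‖ * ‖w 0‖ := by
        simpa only [wedge, norm_mul] using norm_sub_le (v 0 * w 1) (v 1 * w 0)
    _ ≤ ‖v‖ * ‖w‖ + ‖v‖ * ‖w‖ := by gcongr <;> exact norm_le_pi_norm _ _
    _ = 2 * (‖v‖ * ‖w‖) := by ring

theorem dist_mk_mk_le {v w : Fin 2 → 𝕜} (hv : v ≠ 0) (hw : w ≠ 0) (c : 𝕜) :
    dist (Projectivization.mk 𝕜 v hv) (Projectivization.mk 𝕜 w hw) ≤ 2 * ‖v - c • w‖ / ‖v‖ := by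
  have hwedge : wedge v w = wedge (v - c • w) w := by
    simp only [wedge, Pi.sub_apply, Pi.smul_apply, smul_eq_mul]
    ring
  rw [dist_mk_mk, hwedge, div_le_div_iff₀ (by positivity) (by positivity)]
  linear_combination ‖v‖ * norm_wedge_le (v - c • w) w

end ProjectiveMetric

instance {𝕜 : Type*} [RCLike 𝕜] : CompactSpace (ℙ 𝕜 (Fin 2 → 𝕜)) := by
  let unitMk (v : Metric.sphere (0 : Fin 2 → 𝕜) 1) : ℙ 𝕜 (Fin 2 → 𝕜) :=
    Projectivization.mk 𝕜 v.1 (ne_zero_of_mem_unit_sphere v)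
  have hcont : Continuous unitMk := by
    refine (LipschitzWith.of_dist_le_mul (K := 2) fun v w => ?_).continuous
    have hle := dist_mk_mk_le (ne_zero_of_mem_unit_sphere v) (ne_zero_of_mem_unit_sphere w) 1
    rwa [one_smul, mem_sphere_zero_iff_norm.1 v.2, div_one, ← dist_eq_norm] at hle
  rw [← isCompact_univ_iff, ← (Set.range_eq_univ (f := unitMk)).2 fun p => ?_]
  · exact isCompact_range hcont
  · induction p using Projectivization.ind with | h v hv
    have hv1 := norm_smul_inv_norm (𝕜 := 𝕜) hv
    refine ⟨⟨(‖v‖⁻¹ : 𝕜) • v, mem_sphere_zero_iff_norm.2 hv1⟩, ?_⟩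
    rw [mk_eq_mk_iff_wedge, wedge_smul_left, wedge_self, mul_zero]

instance : MeasurableSpace (ℙ ℂ (Fin 2 → ℂ)) := borel _

instance : BorelSpace (ℙ ℂ (Fin 2 → ℂ)) := ⟨rfl⟩

/-- The continuous linear map `v ↦ A v` of the plane. -/
abbrev mulVecCLM (A : SL(2, ℂ)) : (Fin 2 → ℂ) →L[ℂ] Fin 2 → ℂ :=
  LinearMap.toContinuousLinearMap (Matrix.mulVecLin A.1)

theorem norm_le_norm_mulVecCLM_inv_mul (A : SL(2, ℂ)) (v : Fin 2 → ℂ) :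
    ‖v‖ ≤ ‖mulVecCLM A⁻¹‖ * ‖A.1 *ᵥ v‖ := by
  have hv : mulVecCLM A⁻¹ (A.1 *ᵥ v) = v := by
    change A⁻¹.1 *ᵥ (A.1 *ᵥ v) = v
    rw [Matrix.mulVec_mulVec, ← Matrix.SpecialLinearGroup.coe_mul, inv_mul_cancel,
      Matrix.SpecialLinearGroup.coe_one, Matrix.one_mulVec]
  simpa only [hv] using (mulVecCLM A⁻¹).le_opNorm (A.1 *ᵥ v)

instance : ContinuousConstSMul PSL(2, ℂ) (ℙ ℂ (Fin 2 → ℂ)) where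
  continuous_const_smul g := by
    induction g using QuotientGroup.induction_on with | H A
    refine (LipschitzWith.of_dist_le_mul (K := ‖mulVecCLM A⁻¹‖₊ ^ 2) fun p q => ?_).continuous
    induction p using Projectivization.ind with | h v hv
    induction q using Projectivization.ind with | h w hw
    have hAv := mulVec_ne_zero A hv
    have hAw := mulVec_ne_zero A hw
    have hnorm : ‖v‖ * ‖w‖ ≤ ‖mulVecCLM A⁻¹‖ ^ 2 * (‖A.1 *ᵥ v‖ * ‖A.1 *ᵥ w‖) :=
      (mul_le_mul (norm_le_norm_mulVecCLM_inv_mul A v) (norm_le_norm_mulVecCLM_inv_mul A w)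
        (norm_nonneg w) (by positivity)).trans_eq (by ring)
    rw [mk_smul_mk, mk_smul_mk, dist_mk_mk, dist_mk_mk, wedge_mulVec, NNReal.coe_pow, coe_nnnorm,
      ← mul_div_assoc, div_le_div_iff₀ (by positivity) (by positivity)]
    exact (mul_le_mul_of_nonneg_left hnorm (norm_nonneg (wedge v w))).trans_eq (by ring)

/-- The point `[z : 1]` of the projective line. -/
def affinePoint (z : ℂ) : ℙ ℂ (Fin 2 → ℂ) := Projectivization.mk ℂ ![z, 1] fun h => by
  simpa using congrFun h 1

theorem continuous_affinePoint : Continuous affinePoint := by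
  refine (LipschitzWith.of_dist_le_mul (K := 1) fun z w => ?_).continuous
  have hz : 1 ≤ ‖![z, 1]‖ := by simpa using norm_le_pi_norm ![z, 1] 1
  have hw : 1 ≤ ‖![w, 1]‖ := by simpa using norm_le_pi_norm ![w, 1] 1
  rw [affinePoint, affinePoint, dist_mk_mk, NNReal.coe_one, one_mul, dist_eq_norm]
  refine div_le_of_le_mul₀ (by positivity) (norm_nonneg _) ?_
  simpa [wedge] using
    le_mul_of_one_le_right (norm_nonneg (z - w)) (one_le_mul_of_one_le_of_one_le hz hw)

/-! ### Subgroups normalised by a subset of one of their cosets -/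

theorem finite_of_not_three_distinct {α : Type*} {s : Set α}
    (hs : ∀ a ∈ s, ∀ b ∈ s, ∀ c ∈ s, a ≠ b → a ≠ c → b ≠ c → False) : s.Finite := by
  classical
  by_contra hinf
  obtain ⟨t, ht, hcard⟩ := Set.Infinite.exists_subset_card_eq hinf 3
  obtain ⟨a, b, c, hab, hac, hbc, rfl⟩ := Finset.card_eq_three.1 hcard
  exact hs a (ht (by simp)) b (ht (by simp)) c (ht (by simp)) hab hac hbc

theorem finite_fixedBy_of_ne_one {K : Type*} [Field K] {g : PSL(2, K)} (hg : g ≠ 1) :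
    (MulAction.fixedBy (ℙ K (Fin 2 → K)) g).Finite :=
  finite_of_not_three_distinct fun _ ha _ hb _ hc hab hac hbc =>
    hg (eq_one_of_smul_eq_of_ne hab hac hbc ha hb hc)

theorem finite_setOf_finite_orbit {K : Type*} [Field K] (H : Subgroup PSL(2, K)) [Infinite H] :
    {p : ℙ K (Fin 2 → K) | (MulAction.orbit H p).Finite}.Finite := by
  refine finite_of_not_three_distinct fun a ha b hb c hc hab hac hbc => ?_
  have := Set.Finite.to_subtype ha
  have := Set.Finite.to_subtype hb
  have := Set.Finite.to_subtype hc
  let orbitMap (h : H) : MulAction.orbit H a × MulAction.orbit H b × MulAction.orbit H c :=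
    (⟨h • a, h, rfl⟩, ⟨h • b, h, rfl⟩, ⟨h • c, h, rfl⟩)
  refine (Finite.of_injective orbitMap fun h k hhk => ?_).false
  obtain ⟨ha, hb, hc⟩ : h • a = k • a ∧ h • b = k • b ∧ h • c = k • c := by
    simpa only [orbitMap, Prod.mk.injEq, Subtype.ext_iff] using hhk
  have hfix {x : ℙ K (Fin 2 → K)} (hx : h • x = k • x) : (k.1⁻¹ * h.1) • x = x := by
    rw [mul_smul, inv_smul_eq_iff]
    exact hx
  exact Subtype.ext (inv_mul_eq_one.1
    (eq_one_of_smul_eq_of_ne hab hac hbc (hfix ha) (hfix hb) (hfix hc))).symm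

section NormalisedSubgroup

variable {S : Set PSL(2, ℂ)} {H : Subgroup PSL(2, ℂ)}

theorem isElementary_of_finite_orbit [Infinite H] (hconj : ∀ g ∈ S, ∀ h ∈ H, g * h * g⁻¹ ∈ H)
    {p : ℙ ℂ (Fin 2 → ℂ)} (hp : (MulAction.orbit H p).Finite) : IsElementary S := by
  refine IsElementary.of_finite (finite_setOf_finite_orbit H) ⟨p, hp⟩ fun g hg q hq => ?_
  refine (Set.Finite.image (fun r => g⁻¹ • r) hq).subset ?_
  rintro _ ⟨h, rfl⟩
  refine ⟨(g * h * g⁻¹) • q, ⟨⟨_, hconj g hg h h.2⟩, rfl⟩, ?_⟩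
  change g⁻¹ • (g * h * g⁻¹) • q = (h : PSL(2, ℂ)) • g⁻¹ • q
  simp only [mul_smul, inv_smul_smul]

theorem isElementary_of_forall_smul_eq (hcoset : ∀ g ∈ S, ∀ h ∈ S, g * h⁻¹ ∈ H)
    (hconj : ∀ g ∈ S, ∀ h ∈ H, g * h * g⁻¹ ∈ H) {p : ℙ ℂ (Fin 2 → ℂ)}
    (hp : ∀ h ∈ H, h • p = p) : IsElementary S := by
  rcases H.bot_or_exists_ne_one with rfl | ⟨k, hk, hk1⟩
  · rcases S.eq_empty_or_nonempty with rfl | ⟨g, hg⟩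
    · exact Or.inl ⟨1, by simp⟩
    · obtain ⟨q, hq⟩ := exists_smul_eq_self g
      refine IsElementary.of_finite (Set.finite_singleton q) ⟨q, rfl⟩ ?_
      rintro h hh _ rfl
      rw [← mul_inv_eq_one.1 (Subgroup.mem_bot.1 (hcoset g hg h hh)), Set.mem_singleton_iff,
        inv_smul_eq_iff, hq]
  · refine IsElementary.of_finite (F := {q | ∀ h ∈ H, h • q = q})
      ((finite_fixedBy_of_ne_one hk1).subset fun q hq => hq k hk) ⟨p, hp⟩ fun g hg q hq h hh => ?_
    rw [eq_inv_smul_iff, ← mul_smul, ← mul_smul]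
    exact hq _ (hconj g hg h hh)

end NormalisedSubgroup

/-! ### Bounded subgroups -/

section InvariantForm

open scoped ComplexOrder

theorem dotProduct_integral_mulVec {α m n : Type*} [MeasurableSpace α] {μ : Measure α} [Fintype m]
    [Fintype n] {F : α → Matrix m n ℂ} (hF : ∀ i j, Integrable (fun x => F x i j) μ) (v : m → ℂ)
    (w : n → ℂ) :
    v ⬝ᵥ (Matrix.of fun i j => ∫ x, F x i j ∂μ) *ᵥ w = ∫ x, v ⬝ᵥ F x *ᵥ w ∂μ := by
  have hint (i : m) (j : n) : Integrable (fun x => v i * (F x i j * w j)) μ :=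
    ((hF i j).mul_const (w j)).const_mul (v i)
  simp only [dotProduct, Matrix.mulVec, Finset.mul_sum]
  rw [integral_finsetSum _ fun i _ => integrable_finsetSum _ fun j _ => hint i j]
  refine Finset.sum_congr rfl fun i _ => ?_
  rw [integral_finsetSum _ fun j _ => hint i j]
  simp only [integral_const_mul, integral_mul_const, Matrix.of_apply]

/-- Weyl's unitarian trick: average the standard Hermitian form over the group. -/
theorem exists_posDef_conjTranspose_mul_mul_eq {G n : Type*} [Group G] [TopologicalSpace G]
    [IsTopologicalGroup G] [CompactSpace G] [Fintype n] [DecidableEq n] {ρ : G →* Matrix n n ℂ}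
    (hρ : Continuous ρ) : ∃ P : Matrix n n ℂ, P.PosDef ∧ ∀ x, (ρ x)ᴴ * P * ρ x = P := by
  borelize G
  let F (x : G) : Matrix n n ℂ := (ρ x⁻¹)ᴴ * ρ x⁻¹
  have hF : Continuous F :=
    (hρ.comp continuous_inv).matrix_conjTranspose.mul (hρ.comp continuous_inv)
  let P : Matrix n n ℂ := Matrix.of fun i j => ∫ x, F x i j ∂Measure.haar
  have hP (v w : n → ℂ) : v ⬝ᵥ P *ᵥ w = ∫ x, v ⬝ᵥ F x *ᵥ w ∂Measure.haar :=
    dotProduct_integral_mulVec (fun i j =>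
      (hF.matrix_elem i j).integrable_of_hasCompactSupport (.of_compactSpace _)) v w
  refine ⟨P, .of_dotProduct_mulVec_pos ?_ fun v hv => ?_, fun y => ?_⟩
  · ext i j
    simp only [P, Matrix.conjTranspose_apply, Matrix.of_apply, RCLike.star_def, ← integral_conj]
    congr with x
    exact (Matrix.isHermitian_conjTranspose_mul_self (ρ x⁻¹)).apply i j
  · have hsq (x : G) : star v ⬝ᵥ F x *ᵥ v = ((∑ i, ‖(ρ x⁻¹ *ᵥ v) i‖ ^ 2 : ℝ) : ℂ) := by
      rw [← Matrix.mulVec_mulVec, Matrix.dotProduct_mulVec, ← Matrix.star_mulVec]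
      simp [dotProduct, Complex.conj_mul']
    have hcont : Continuous fun x => ∑ i, ‖(ρ x⁻¹ *ᵥ v) i‖ ^ 2 := continuous_finsetSum _ fun i _ =>
      ((continuous_apply i).comp
        ((hρ.comp continuous_inv).matrix_mulVec continuous_const)).norm.pow 2
    simp only [hP, hsq, integral_complex_ofReal, Complex.zero_lt_real]
    refine hcont.integral_pos_of_hasCompactSupport_nonneg_nonzero (x := 1)
      (.of_compactSpace _) (fun x => by positivity) fun h => hv (funext fun i => ?_)
    simpa using
      (Finset.sum_eq_zero_iff_of_nonneg fun i _ => by positivity).1 h i (Finset.mem_univ i)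
  · have hentry (X : Matrix n n ℂ) (i j : n) :
        ((ρ y)ᴴ * X * ρ y) i j = star ((ρ y).col i) ⬝ᵥ X *ᵥ (ρ y).col j := by
      rw [Matrix.mul_assoc]
      rfl
    have hinv (x : G) : (ρ y)ᴴ * F x * ρ y = F (y⁻¹ * x) := by
      simp only [F, mul_inv_rev, inv_inv, map_mul, Matrix.conjTranspose_mul, Matrix.mul_assoc]
    ext i j
    rw [hentry, hP]
    simp only [← hentry, hinv]
    exact integral_mul_left_eq_self (fun x => F x i j) y⁻¹

open scoped MatrixOrder Matrix.Norms.L2Operator in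
theorem exists_SL_conjTranspose_mul_self_eq_smul {n : Type*} [Fintype n] [DecidableEq n]
    [Nonempty n] {P : Matrix n n ℂ} (hP : P.PosDef) :
    ∃ (h : Matrix.SpecialLinearGroup n ℂ) (c : ℂ), h.1ᴴ * h.1 = c • P := by
  obtain ⟨X, hX, rfl⟩ :=
    CStarAlgebra.isStrictlyPositive_iff_eq_star_mul_self.1 hP.isStrictlyPositive
  obtain ⟨s, hs⟩ := IsAlgClosed.exists_pow_nat_eq X.det (Fintype.card_pos (α := n))
  have hdet : X.det ≠ 0 := ((Matrix.isUnit_iff_isUnit_det X).1 hX).ne_zero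
  refine ⟨⟨s⁻¹ • X, ?_⟩, star s⁻¹ * s⁻¹, ?_⟩
  · rw [Matrix.det_smul, inv_pow, hs, inv_mul_cancel₀ hdet]
  · rw [Matrix.conjTranspose_smul, Matrix.smul_mul, Matrix.mul_smul, smul_smul,
      Matrix.star_eq_conjTranspose]

theorem commute_inv_mul_of_conjTranspose_mul_mul_eq {n R : Type*} [Fintype n] [DecidableEq n]
    [CommRing R] [StarRing R] {P Q A : Matrix n n R} (hP : IsUnit P) (hA : IsUnit A)
    (hPA : Aᴴ * P * A = P) (hQA : Aᴴ * Q * A = Q) : Commute (P⁻¹ * Q) A := by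
  have hdet := (Matrix.isUnit_iff_isUnit_det P).1 hP
  refine (hA.star.mul hP).mul_left_cancel ?_
  rw [Matrix.star_eq_conjTranspose]
  calc Aᴴ * P * (P⁻¹ * Q * A) = Aᴴ * Q * A := by
        simp only [Matrix.mul_assoc, Matrix.mul_nonsing_inv_cancel_left _ _ hdet]
    _ = Aᴴ * P * A * (P⁻¹ * Q) := by rw [hPA, hQA, Matrix.mul_nonsing_inv_cancel_left _ _ hdet]
    _ = Aᴴ * P * (A * (P⁻¹ * Q)) := Matrix.mul_assoc _ _ _

theorem eq_of_posDef_smul_of_det_eq {P : Matrix (Fin 2) (Fin 2) ℂ} {c : ℂ} (hP : P.PosDef)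
    (hcP : (c • P).PosDef) (hdet : (c • P).det = P.det) : c • P = P := by
  have hc : c ^ 2 = 1 := by
    rw [Matrix.det_smul, Fintype.card_fin] at hdet
    exact mul_eq_right₀ hP.det_pos.ne' |>.1 hdet
  rcases sq_eq_one_iff.1 hc with rfl | rfl
  · exact one_smul ℂ P
  · have hdiag := hcP.diag_pos (i := 0)
    rw [Matrix.smul_apply, smul_eq_mul, neg_one_mul, neg_pos] at hdiag
    exact (hdiag.asymm hP.diag_pos).elim

theorem exists_forall_smul_eq_of_commute {K : Type*} [Field K] [IsAlgClosed K]
    {H : Subgroup PSL(2, K)} {M : Matrix (Fin 2) (Fin 2) K} (hM : ∀ c : K, M ≠ c • 1)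
    (hcomm : ∀ A : SL(2, K), (QuotientGroup.mk A : PSL(2, K)) ∈ H → Commute M A.1) :
    ∃ p : ℙ K (Fin 2 → K), ∀ h ∈ H, h • p = p := by
  obtain ⟨c, hc⟩ := Module.End.exists_eigenvalue (Matrix.toLin' M)
  obtain ⟨v, hv⟩ := hc.exists_hasEigenvector
  have hMv : M *ᵥ v = c • v := hv.apply_eq_smul
  refine ⟨Projectivization.mk K v hv.2, fun h hh => ?_⟩
  induction h using QuotientGroup.induction_on with | H A
  rw [mk_smul_mk_eq_mk_iff]
  by_contra hw
  have hMw : M *ᵥ (A.1 *ᵥ v) = c • (A.1 *ᵥ v) := by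
    rw [Matrix.mulVec_mulVec, (hcomm A hh).eq, ← Matrix.mulVec_mulVec, hMv, Matrix.mulVec_smul]
  refine hM c (Matrix.ext_of_mulVec_single fun i => ?_)
  have hplucker := wedge_smul_eq_add (A.1 *ᵥ v) (Pi.single i 1) v
  apply smul_right_injective _ hw
  simp only [Matrix.smul_mulVec, Matrix.one_mulVec, smul_comm _ c]
  rw [← Matrix.mulVec_smul, hplucker]
  simp only [Matrix.mulVec_add, Matrix.mulVec_smul, hMv, hMw, smul_add, smul_comm _ c]

theorem exists_conj_mem_PSU2_of_conjTranspose_mul_mul_eq {S : Set PSL(2, ℂ)}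
    {P : Matrix (Fin 2) (Fin 2) ℂ} (hP : P.PosDef)
    (hS : ∀ B : SL(2, ℂ), (QuotientGroup.mk B : PSL(2, ℂ)) ∈ S → B.1ᴴ * P * B.1 = P) :
    ∃ h : PSL(2, ℂ), ∀ g ∈ S, h * g * h⁻¹ ∈ PSU2 := by
  obtain ⟨h, c, hc⟩ := exists_SL_conjTranspose_mul_self_eq_smul hP
  refine ⟨QuotientGroup.mk h, fun g hg => ?_⟩
  induction g using QuotientGroup.induction_on with | H B
  have hh : h.1 * h⁻¹.1 = 1 := by
    rw [← Matrix.SpecialLinearGroup.coe_mul, mul_inv_cancel, Matrix.SpecialLinearGroup.coe_one]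
  change QuotientGroup.mk (h * B * h⁻¹) ∈ PSU2
  rw [mk_mem_PSU2_iff, mul_eq_one_comm]
  simp only [Matrix.SpecialLinearGroup.coe_mul, Matrix.conjTranspose_mul]
  calc (h⁻¹.1)ᴴ * (B.1ᴴ * h.1ᴴ) * (h.1 * B.1 * h⁻¹.1)
      = (h⁻¹.1)ᴴ * (B.1ᴴ * (h.1ᴴ * h.1) * B.1) * h⁻¹.1 := by simp only [Matrix.mul_assoc]
    _ = (h⁻¹.1)ᴴ * (h.1ᴴ * h.1) * h⁻¹.1 := by
      rw [hc, Matrix.mul_smul, Matrix.smul_mul, hS B hg]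
    _ = (h.1 * h⁻¹.1)ᴴ * (h.1 * h⁻¹.1) := by
      simp only [Matrix.conjTranspose_mul, Matrix.mul_assoc]
    _ = 1 := by rw [hh, Matrix.conjTranspose_one, one_mul]

theorem isElementary_of_forall_conjTranspose_mul_mul_eq {S : Set PSL(2, ℂ)} {H : Subgroup PSL(2, ℂ)}
    (hcoset : ∀ g ∈ S, ∀ h ∈ S, g * h⁻¹ ∈ H) (hconj : ∀ g ∈ S, ∀ h ∈ H, g * h * g⁻¹ ∈ H)
    {P : Matrix (Fin 2) (Fin 2) ℂ} (hP : P.PosDef)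
    (hH : ∀ A : SL(2, ℂ), (QuotientGroup.mk A : PSL(2, ℂ)) ∈ H → A.1ᴴ * P * A.1 = P) :
    IsElementary S := by
  by_cases hS : ∀ B : SL(2, ℂ), (QuotientGroup.mk B : PSL(2, ℂ)) ∈ S → B.1ᴴ * P * B.1 = P
  · exact Or.inl (exists_conj_mem_PSU2_of_conjTranspose_mul_mul_eq hP hS)
  push Not at hS
  obtain ⟨B, hB, hBP⟩ := hS
  have hunit (A : SL(2, ℂ)) : IsUnit A.1 := (Matrix.isUnit_iff_isUnit_det _).2 (by simp [A.2])
  have hPunit : IsUnit P.det := hP.det_pos.ne'.isUnit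
  have hnonscalar (c : ℂ) : P⁻¹ * (B.1ᴴ * P * B.1) ≠ c • 1 := fun hc => by
    have hcP : B.1ᴴ * P * B.1 = c • P := by
      rw [← Matrix.mul_nonsing_inv_cancel_left P (B.1ᴴ * P * B.1) hPunit, hc, Matrix.mul_smul,
        mul_one]
    refine hBP (hcP.trans (eq_of_posDef_smul_of_det_eq hP (hcP ▸ ?_) ?_))
    · exact hP.conjTranspose_mul_mul_same (Matrix.mulVec_injective_iff_isUnit.2 (hunit B))
    · simp [← hcP, Matrix.det_mul, Matrix.det_conjTranspose]
  have hBinv (A : SL(2, ℂ)) (hA : (QuotientGroup.mk A : PSL(2, ℂ)) ∈ H) :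
      A.1ᴴ * (B.1ᴴ * P * B.1) * A.1 = B.1ᴴ * P * B.1 := by
    have hBA : B.1 * A.1 = (B * A * B⁻¹).1 * B.1 := by
      rw [← Matrix.SpecialLinearGroup.coe_mul, ← Matrix.SpecialLinearGroup.coe_mul,
        inv_mul_cancel_right]
    calc A.1ᴴ * (B.1ᴴ * P * B.1) * A.1 = (B.1 * A.1)ᴴ * P * (B.1 * A.1) := by
          simp only [Matrix.conjTranspose_mul, Matrix.mul_assoc]
      _ = B.1ᴴ * ((B * A * B⁻¹).1ᴴ * P * (B * A * B⁻¹).1) * B.1 := by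
          rw [hBA, Matrix.conjTranspose_mul]
          simp only [Matrix.mul_assoc]
      _ = B.1ᴴ * P * B.1 := by rw [hH _ (hconj _ hB _ hA)]
  obtain ⟨p, hp⟩ := exists_forall_smul_eq_of_commute hnonscalar fun A hA =>
    commute_inv_mul_of_conjTranspose_mul_mul_eq hP.isUnit (hunit A) (hH A hA) (hBinv A hA)
  exact isElementary_of_forall_smul_eq hcoset hconj hp

theorem exists_posDef_of_isCompact {n : Type*} [Fintype n] [DecidableEq n]
    {K : Subgroup (Matrix.SpecialLinearGroup n ℂ)}
    (hK : IsCompact (K : Set (Matrix.SpecialLinearGroup n ℂ))) :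
    ∃ P : Matrix n n ℂ, P.PosDef ∧ ∀ A ∈ K, A.1ᴴ * P * A.1 = P := by
  have : CompactSpace K := isCompact_iff_compactSpace.1 hK
  let ρ : K →* Matrix n n ℂ :=
    { toFun := fun A => A.1.1
      map_one' := rfl
      map_mul' := fun A B => Matrix.SpecialLinearGroup.coe_mul A.1 B.1 }
  have hρ : Continuous ρ := continuous_subtype_val.comp continuous_subtype_val
  obtain ⟨P, hP, hinv⟩ := exists_posDef_conjTranspose_mul_mul_eq hρ
  exact ⟨P, hP, fun A hA => hinv ⟨A, hA⟩⟩

theorem isElementary_of_isCompact_closure {S : Set PSL(2, ℂ)} {H : Subgroup PSL(2, ℂ)}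
    (hcoset : ∀ g ∈ S, ∀ h ∈ S, g * h⁻¹ ∈ H) (hconj : ∀ g ∈ S, ∀ h ∈ H, g * h * g⁻¹ ∈ H)
    (hH : IsCompact (closure {A : SL(2, ℂ) | (QuotientGroup.mk A : PSL(2, ℂ)) ∈ H})) :
    IsElementary S := by
  obtain ⟨P, hP, hinv⟩ :=
    exists_posDef_of_isCompact (K := (H.comap (QuotientGroup.mk' _)).topologicalClosure) hH
  exact isElementary_of_forall_conjTranspose_mul_mul_eq hcoset hconj hP fun A hA =>
    hinv A (subset_closure hA)

end InvariantForm

/-! ### Contractions in unbounded sets of matrices -/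

theorem exists_lt_norm_mulVecCLM {K : Set SL(2, ℂ)} (hK : ¬ IsCompact (closure K)) (C : ℝ) :
    ∃ A ∈ K, C < ‖mulVecCLM A‖ := by
  by_contra! hbdd
  let box : Set (Matrix (Fin 2) (Fin 2) ℂ) :=
    Set.univ.pi fun _ => Set.univ.pi fun _ => Metric.closedBall 0 C
  have hbox : IsCompact box :=
    isCompact_univ_pi fun _ => isCompact_univ_pi fun _ => isCompact_closedBall 0 C
  refine hK ((Matrix.SpecialLinearGroup.isClosedEmbedding_val.isCompact_preimage
    hbox).closure_of_subset fun A hA i _ j _ => ?_)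
  rw [mem_closedBall_zero_iff]
  calc ‖A.1 i j‖ = ‖mulVecCLM A (Pi.single j 1) i‖ := by simp
    _ ≤ ‖mulVecCLM A (Pi.single j 1)‖ := norm_le_pi_norm _ i
    _ ≤ ‖mulVecCLM A‖ * ‖(Pi.single j 1 : Fin 2 → ℂ)‖ := (mulVecCLM A).le_opNorm _
    _ = ‖mulVecCLM A‖ := by rw [Pi.norm_single, norm_one, mul_one]
    _ ≤ C := hbdd A hA

theorem exists_eq_wedge_smul {K : Type*} [Field K] {Y : (Fin 2 → K) →ₗ[K] Fin 2 → K} (hY : Y ≠ 0)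
    (hwedge : ∀ v w, wedge (Y v) (Y w) = 0) :
    ∃ a b : Fin 2 → K, a ≠ 0 ∧ b ≠ 0 ∧ ∀ v, Y v = wedge v b • a := by
  obtain ⟨x, hx⟩ : ∃ x, Y x ≠ 0 := by
    by_contra! h
    exact hY (LinearMap.ext h)
  obtain ⟨y, hy⟩ := exists_wedge_eq_one hx
  let b : Fin 2 → K := ![-wedge y (Y (Pi.single 1 1)), wedge y (Y (Pi.single 0 1))]
  have hb (v : Fin 2 → K) : wedge v b = wedge y (Y v) := by
    have hv : v = v 0 • Pi.single 0 1 + v 1 • Pi.single 1 1 := by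
      ext i
      fin_cases i <;> simp
    conv_rhs => rw [hv, map_add, map_smul, map_smul]
    simp only [wedge, b, Pi.add_apply, Pi.smul_apply, smul_eq_mul, Matrix.cons_val_zero,
      Matrix.cons_val_one]
    ring
  have hY' (v : Fin 2 → K) : Y v = wedge v b • Y x := by
    have hplucker := wedge_smul_eq_add y (Y v) (Y x)
    rwa [hy, one_smul, hwedge, zero_smul, zero_add, ← hb] at hplucker
  refine ⟨Y x, b, hx, fun hb0 => hx ?_, hY'⟩
  rw [hY' x, hb0]
  simp [wedge]

theorem exists_tendsto_smul_mulVecCLM {K : Set SL(2, ℂ)} (hK : ¬ IsCompact (closure K)) :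
    ∃ Y : (Fin 2 → ℂ) →L[ℂ] Fin 2 → ℂ, Y ≠ 0 ∧ (∀ v w, wedge (Y v) (Y w) = 0) ∧
      ∀ η > 0, ∃ A ∈ K, ∃ c : ℂ, c ≠ 0 ∧ ‖c • mulVecCLM A - Y‖ < η := by
  choose A hAK hA using fun k : ℕ => exists_lt_norm_mulVecCLM hK k
  have hpos (k : ℕ) : 0 < ‖mulVecCLM (A k)‖ := (Nat.cast_nonneg k).trans_lt (hA k)
  let c (k : ℕ) : ℂ := (‖mulVecCLM (A k)‖⁻¹ : ℝ)
  have hclim : Filter.Tendsto c Filter.atTop (nhds 0) := by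
    have hlim := (Filter.tendsto_atTop_mono (fun k => (hA k).le)
      tendsto_natCast_atTop_atTop).inv_tendsto_atTop
    exact (Complex.continuous_ofReal.tendsto' 0 0 Complex.ofReal_zero).comp hlim
  have hsphere (k : ℕ) : c k • mulVecCLM (A k) ∈
      Metric.sphere (0 : (Fin 2 → ℂ) →L[ℂ] Fin 2 → ℂ) 1 := by
    rw [mem_sphere_zero_iff_norm, norm_smul, Complex.norm_real, norm_inv, norm_norm,
      inv_mul_cancel₀ (hpos k).ne']
  have : ProperSpace ((Fin 2 → ℂ) →L[ℂ] Fin 2 → ℂ) := FiniteDimensional.proper ℂ _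
  obtain ⟨Y, hY, φ, hφ, hlim⟩ := (isCompact_sphere _ _).tendsto_subseq hsphere
  refine ⟨Y, ne_zero_of_mem_unit_sphere ⟨Y, hY⟩, fun v w => ?_, fun η hη => ?_⟩
  · have happ (u : Fin 2 → ℂ) : Filter.Tendsto (fun k => c (φ k) • ((A (φ k)).1 *ᵥ u))
        Filter.atTop (nhds (Y u)) :=
      ((ContinuousLinearMap.apply ℂ (Fin 2 → ℂ) u).continuous.tendsto Y).comp hlim
    refine tendsto_nhds_unique
      ((continuous_wedge.tendsto (Y v, Y w)).comp ((happ v).prodMk_nhds (happ w))) ?_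
    have hc := hclim.comp hφ.tendsto_atTop
    simpa only [Function.comp_def, wedge_smul_left, wedge_smul_right, wedge_mulVec, zero_mul] using
      hc.mul (hc.mul_const (wedge v w))
  · obtain ⟨k, hk⟩ := (hlim.eventually (Metric.ball_mem_nhds Y hη)).exists
    refine ⟨A (φ k), hAK _, c (φ k), Complex.ofReal_ne_zero.2 (inv_pos.2 (hpos _)).ne', ?_⟩
    rw [← dist_eq_norm]
    exact hk

theorem exists_forall_dist_le {K : Set SL(2, ℂ)} (hK : ¬ IsCompact (closure K)) :
    ∃ p q : ℙ ℂ (Fin 2 → ℂ), ∀ ε > 0, ∀ δ > 0, ∃ A ∈ K, ∀ x, ε ≤ dist x q →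
      dist ((QuotientGroup.mk A : PSL(2, ℂ)) • x) p ≤ δ := by
  obtain ⟨Y, hY0, hwedge, hlim⟩ := exists_tendsto_smul_mulVecCLM hK
  obtain ⟨a, b, ha, hb, hab⟩ := exists_eq_wedge_smul (Y := Y.toLinearMap)
    (fun h => hY0 (ContinuousLinearMap.coe_injective h)) hwedge
  replace hab : ∀ v, Y v = wedge v b • a := hab
  refine ⟨Projectivization.mk ℂ a ha, Projectivization.mk ℂ b hb, fun ε hε δ hδ => ?_⟩
  let r := ε * ‖b‖ * ‖a‖ / 2
  have hr : 0 < r := by positivity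
  obtain ⟨A, hA, c, hc, hη⟩ := hlim _ (lt_min hr (half_pos (mul_pos hr hδ)))
  refine ⟨A, hA, fun x hx => ?_⟩
  induction x using Projectivization.ind with | h v hv
  have hv' := norm_pos_iff.2 hv
  rw [dist_mk_mk, le_div_iff₀ (by positivity)] at hx
  have hAv : c • (A.1 *ᵥ v) ≠ 0 := smul_ne_zero hc (mulVec_ne_zero A hv)
  have hmk : (QuotientGroup.mk A : PSL(2, ℂ)) • Projectivization.mk ℂ v hv =
      Projectivization.mk ℂ (c • (A.1 *ᵥ v)) hAv := by
    rw [mk_smul_mk, mk_eq_mk_iff_wedge, wedge_smul_right, wedge_self, mul_zero]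
  have herr : ‖c • (A.1 *ᵥ v) - Y v‖ ≤ min r (r * δ / 2) * ‖v‖ :=
    (c • mulVecCLM A - Y).le_of_opNorm_le hη.le v
  have hYv : 2 * r * ‖v‖ ≤ ‖Y v‖ := by
    rw [hab, norm_smul]
    linear_combination ‖a‖ * hx
  have hlow : r * ‖v‖ ≤ ‖c • (A.1 *ᵥ v)‖ := by
    have hr_err := herr.trans (mul_le_mul_of_nonneg_right (min_le_left _ _) hv'.le)
    linarith [norm_sub_norm_le (Y v) (c • (A.1 *ᵥ v)), norm_sub_rev (Y v) (c • (A.1 *ᵥ v))]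
  have hup : 2 * ‖c • (A.1 *ᵥ v) - Y v‖ ≤ δ * (r * ‖v‖) := by
    linear_combination 2 * herr.trans (mul_le_mul_of_nonneg_right (min_le_right _ _) hv'.le)
  rw [hmk]
  refine (dist_mk_mk_le hAv ha (wedge v b)).trans (div_le_of_le_mul₀ (norm_nonneg _) hδ.le ?_)
  rw [← hab]
  exact hup.trans (mul_le_mul_of_nonneg_left hlow hδ.le)

theorem infinite_of_not_isCompact_closure {H : Subgroup PSL(2, ℂ)}
    (hH : ¬ IsCompact (closure {A : SL(2, ℂ) | (QuotientGroup.mk A : PSL(2, ℂ)) ∈ H})) :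
    Infinite H := by
  by_contra hfin
  have : Finite H := not_infinite_iff_finite.1 hfin
  refine hH (Set.Finite.isCompact ?_).closure
  refine (Set.toFinite (H : Set PSL(2, ℂ))).preimage' fun g _ => ?_
  induction g using QuotientGroup.induction_on with | H A
  exact (Set.toFinite {A, -A}).subset fun B hB => mk_eq_mk_iff_eq_or_eq_neg.1 (Eq.symm hB)

/-! ### Measures on the projective line and their stabilisers -/

/-- The subgroup of the elements of `G` that preserve the measure `m`. -/
def measureStabilizer (G : Type*) {X : Type*} [Group G] [MulAction G X] [MeasurableSpace X]
    [MeasurableConstSMul G X] (m : Measure X) : Subgroup G where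
  carrier := {g | m.map (g • ·) = m}
  one_mem' := by simp
  mul_mem' {g h} hg hh := by
    have hmap := Measure.map_map (μ := m) (measurable_const_smul g) (measurable_const_smul h)
    rw [hh.out, hg.out] at hmap
    simpa only [Set.mem_ofPred_eq, Function.comp_def, smul_smul] using hmap.symm
  inv_mem' {g} hg := by
    have hmap := Measure.map_map (μ := m) (measurable_const_smul g⁻¹) (measurable_const_smul g)
    rw [hg.out] at hmap
    simpa [Function.comp_def] using hmap

section MeasureStabilizer

variable {G X : Type*} [Group G] [MulAction G X] [MeasurableSpace X] [MeasurableConstSMul G X]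

theorem measure_preimage_smul_of_mem_measureStabilizer {m : Measure X} {g : G}
    (hg : g ∈ measureStabilizer G m) {B : Set X} (hB : MeasurableSet B) :
    m ((g • ·) ⁻¹' B) = m B := by
  rw [← Measure.map_apply (measurable_const_smul g) hB, hg.out]

theorem finite_orbit_of_measure_singleton_ne_zero [MeasurableSingletonClass X] {m : Measure X}
    [IsFiniteMeasure m] {H : Subgroup G} (hH : H ≤ measureStabilizer G m) {p : X}
    (hp : m {p} ≠ 0) : (MulAction.orbit H p).Finite := by
  have hfin : {q | m {p} ≤ m {q}}.Finite :=
    Measure.finite_const_le_meas_of_disjoint_iUnion m (pos_iff_ne_zero.2 hp)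
      measurableSet_singleton (fun q r hqr => Set.disjoint_singleton.2 hqr)
      (measure_ne_top m _)
  refine hfin.subset ?_
  rintro _ ⟨h, rfl⟩
  calc m {p} ≤ m ((h.1 • ·) ⁻¹' {h.1 • p}) := measure_mono (Set.singleton_subset_iff.2 rfl)
    _ = m {h.1 • p} :=
      measure_preimage_smul_of_mem_measureStabilizer (hH h.2) (measurableSet_singleton _)

variable {M : ℕ → Measure X} {S : Set G}

theorem mul_inv_mem_iInf_measureStabilizer (hS : ∀ g ∈ S, ∀ N, (M (N + 1)).map (g • ·) = M N)
    {g h : G} (hg : g ∈ S) (hh : h ∈ S) : g * h⁻¹ ∈ ⨅ N, measureStabilizer G (M N) := by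
  refine Subgroup.mem_iInf.2 fun N => ?_
  change (M N).map ((g * h⁻¹) • ·) = M N
  nth_rw 1 [← hS h hh N]
  rw [Measure.map_map (measurable_const_smul _) (measurable_const_smul _)]
  simpa only [Function.comp_def, mul_smul, inv_smul_smul] using hS g hg N

theorem conj_mem_iInf_measureStabilizer (hS : ∀ g ∈ S, ∀ N, (M (N + 1)).map (g • ·) = M N)
    {g h : G} (hg : g ∈ S) (hh : h ∈ ⨅ N, measureStabilizer G (M N)) :
    g * h * g⁻¹ ∈ ⨅ N, measureStabilizer G (M N) := by
  refine Subgroup.mem_iInf.2 fun N => ?_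
  change (M N).map ((g * h * g⁻¹) • ·) = M N
  have hM : (M (N + 1)).map (h • ·) = M (N + 1) := Subgroup.mem_iInf.1 hh (N + 1)
  calc (M N).map ((g * h * g⁻¹) • ·) = (M (N + 1)).map ((g * h) • ·) := by
        rw [← hS g hg N, Measure.map_map (measurable_const_smul _) (measurable_const_smul _)]
        simp only [Function.comp_def, mul_smul, inv_smul_smul]
    _ = ((M (N + 1)).map (h • ·)).map (g • ·) := by
        rw [Measure.map_map (measurable_const_smul _) (measurable_const_smul _)]
        simp only [Function.comp_def, mul_smul]
    _ = M N := by rw [hM, hS g hg N]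

end MeasureStabilizer

open Filter Topology in
theorem measure_univ_le_add_of_forall_smul {X G : Type*} [MetricSpace X] [MeasurableSpace X]
    [OpensMeasurableSpace X] [Group G] [MulAction G X] [MeasurableConstSMul G X] {m : Measure X}
    [IsFiniteMeasure m] {p q : X} (hpq : ∀ ε > 0, ∀ δ > 0, ∃ g ∈ measureStabilizer G m, ∀ x,
      ε ≤ dist x q → dist (g • x) p ≤ δ) : m Set.univ ≤ m {p} + m {q} := by
  have hball (x : X) : Tendsto (fun r => m (Metric.closedBall x r)) (𝓝[>] 0) (𝓝 (m {x})) := by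
    have hlim := (tendsto_measure_cthickening_of_isClosed (μ := m) ⟨1, one_pos, measure_ne_top m _⟩
      (isClosed_singleton (x := x))).mono_left (nhdsWithin_le_nhds (s := Set.Ioi 0))
    refine hlim.congr' (eventually_mem_nhdsWithin.mono fun r hr => ?_)
    rw [Metric.cthickening_singleton x (le_of_lt hr)]
  refine ge_of_tendsto ((hball p).add (hball q)) ?_
  filter_upwards [self_mem_nhdsWithin] with r hr
  obtain ⟨g, hg, hgpq⟩ := hpq r hr r hr
  rw [← measure_preimage_smul_of_mem_measureStabilizer hg measurableSet_closedBall]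
  refine (measure_mono fun x _ => ?_).trans (measure_union_le _ _)
  exact (le_total r (dist x q)).imp (hgpq x) id

theorem isElementary_of_forall_map_smul_eq {S : Set PSL(2, ℂ)}
    {M : ℕ → Measure (ℙ ℂ (Fin 2 → ℂ))} [∀ N, IsProbabilityMeasure (M N)]
    (hS : ∀ g ∈ S, ∀ N, (M (N + 1)).map (g • ·) = M N) : IsElementary S := by
  let H := ⨅ N, measureStabilizer PSL(2, ℂ) (M N)
  have hconj : ∀ g ∈ S, ∀ h ∈ H, g * h * g⁻¹ ∈ H := fun g hg h hh =>
    conj_mem_iInf_measureStabilizer hS hg hh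
  by_cases hH : IsCompact (closure {A : SL(2, ℂ) | (QuotientGroup.mk A : PSL(2, ℂ)) ∈ H})
  · exact isElementary_of_isCompact_closure
      (fun g hg h hh => mul_inv_mem_iInf_measureStabilizer hS hg hh) hconj hH
  · have := infinite_of_not_isCompact_closure hH
    have hH0 : H ≤ measureStabilizer PSL(2, ℂ) (M 0) := iInf_le _ 0
    obtain ⟨p, q, hpq⟩ := exists_forall_dist_le hH
    have hatom : 1 ≤ M 0 {p} + M 0 {q} := by
      rw [← measure_univ (μ := M 0)]
      refine measure_univ_le_add_of_forall_smul (G := PSL(2, ℂ)) fun ε hε δ hδ => ?_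
      obtain ⟨A, hA, hAx⟩ := hpq ε hε δ hδ
      exact ⟨_, hH0 hA, hAx⟩
    obtain hp | hq : M 0 {p} ≠ 0 ∨ M 0 {q} ≠ 0 := by
      by_contra! h
      simp [h.1, h.2] at hatom
    · exact isElementary_of_finite_orbit hconj
        (finite_orbit_of_measure_singleton_ne_zero hH0 hp)
    · exact isElementary_of_finite_orbit hconj
        (finite_orbit_of_measure_singleton_ne_zero hH0 hq)

/-! ### Homographies in the affine coordinate -/

instance : SecondCountableTopology PSL(2, ℂ) :=
  have : SecondCountableTopology (Matrix (Fin 2) (Fin 2) ℂ) :=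
    inferInstanceAs (SecondCountableTopology (Fin 2 → Fin 2 → ℂ))
  have : SecondCountableTopology SL(2, ℂ) :=
    Topology.IsInducing.subtypeVal.secondCountableTopology
  QuotientGroup.instSecondCountableTopology _

/-- The product of the coordinates of index `i` and `1` of the vector `A (z, 1)`, which only depends
on the class of `A` in `PSL₂(ℂ)`. -/
def affineProd (i : Fin 2) (g : PSL(2, ℂ)) (z : ℂ) : ℂ :=
  Quotient.liftOn' g (fun A => (A.1 *ᵥ ![z, 1]) i * (A.1 *ᵥ ![z, 1]) 1) fun A B h => by
    rcases mk_eq_mk_iff_eq_or_eq_neg.1 (Quotient.sound' h) with rfl | rfl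
    · rfl
    · simp only [Matrix.SpecialLinearGroup.coe_neg, Matrix.neg_mulVec, Pi.neg_apply, neg_mul_neg]

theorem continuous_affineProd (i : Fin 2) :
    Continuous fun p : PSL(2, ℂ) × ℂ => affineProd i p.1 p.2 := by
  have hquot : Topology.IsQuotientMap
      (Prod.map QuotientGroup.mk id : SL(2, ℂ) × ℂ → PSL(2, ℂ) × ℂ) :=
    (QuotientGroup.isOpenQuotientMap_mk.prodMap IsOpenQuotientMap.id).isQuotientMap
  have hvec : Continuous fun p : SL(2, ℂ) × ℂ => p.1.1 *ᵥ ![p.2, 1] := by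
    refine (continuous_subtype_val.comp continuous_fst).matrix_mulVec (continuous_pi fun j => ?_)
    fin_cases j
    exacts [continuous_snd, continuous_const]
  exact hquot.continuous_iff.2
    (((continuous_apply i).comp hvec).mul ((continuous_apply 1).comp hvec))

/-- The square `(c z + d)²` of the denominator of the homography `z ↦ (a z + b) / (c z + d)`. -/
abbrev denomSq (g : PSL(2, ℂ)) (z : ℂ) : ℂ := affineProd 1 g z

/-- The homography `z ↦ (a z + b) / (c z + d)`, with the value `0` at its pole. -/
def homography (g : PSL(2, ℂ)) (z : ℂ) : ℂ := affineProd 0 g z / denomSq g z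

theorem denomSq_mk (A : SL(2, ℂ)) (z : ℂ) :
    denomSq (QuotientGroup.mk A) z = (A 1 0 * z + A 1 1) ^ 2 := by
  change (A.1 *ᵥ ![z, 1]) 1 * (A.1 *ᵥ ![z, 1]) 1 = _
  simp [sq]

theorem homography_mk (A : SL(2, ℂ)) (z : ℂ) :
    homography (QuotientGroup.mk A) z = (A 0 0 * z + A 0 1) / (A 1 0 * z + A 1 1) := by
  rw [homography, denomSq_mk, sq]
  change (A.1 *ᵥ ![z, 1]) 0 * (A.1 *ᵥ ![z, 1]) 1 / _ = _
  rw [mul_div_mul_comm]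
  by_cases hd : A 1 0 * z + A 1 1 = 0 <;> simp [hd]

theorem affinePoint_injective : Function.Injective affinePoint := fun z w h => by
  simpa [wedge, sub_eq_zero] using (mk_eq_mk_iff_wedge _ _).1 h

theorem smul_affinePoint_eq_iff {g : PSL(2, ℂ)} {z w : ℂ} :
    g • affinePoint z = affinePoint w ↔ denomSq g z ≠ 0 ∧ homography g z = w := by
  induction g using QuotientGroup.induction_on with | H A
  rw [affinePoint, affinePoint, mk_smul_mk_eq_mk_iff, denomSq_mk, homography_mk,
    pow_ne_zero_iff two_ne_zero]
  have hwedge : wedge (A.1 *ᵥ ![z, 1]) ![w, 1] =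
      A 0 0 * z + A 0 1 - (A 1 0 * z + A 1 1) * w := by
    simp [wedge]
  rw [hwedge, sub_eq_zero]
  refine ⟨fun h => ?_, fun ⟨hd, hw⟩ => by rw [← hw, mul_div_cancel₀ _ hd]⟩
  have hd : A 1 0 * z + A 1 1 ≠ 0 := fun hd => by
    have hdet := A.2
    rw [Matrix.det_fin_two] at hdet
    rw [hd, zero_mul] at h
    exact one_ne_zero (α := ℂ) (by linear_combination A 0 0 * hd - A 1 0 * h - hdet)
  exact ⟨hd, by rw [h, mul_div_cancel_left₀ _ hd]⟩

theorem smul_affinePoint {g : PSL(2, ℂ)} {z : ℂ} (hz : denomSq g z ≠ 0) :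
    g • affinePoint z = affinePoint (homography g z) :=
  smul_affinePoint_eq_iff.2 ⟨hz, rfl⟩

theorem injOn_homography (g : PSL(2, ℂ)) : Set.InjOn (homography g) {z | denomSq g z ≠ 0} :=
  fun z hz w hw h => affinePoint_injective <| smul_left_cancel g <| by
    rw [smul_affinePoint hz, smul_affinePoint hw, h]

theorem image_homography (g : PSL(2, ℂ)) :
    homography g '' {z | denomSq g z ≠ 0} = {w | denomSq g⁻¹ w ≠ 0} := by
  ext w
  constructor
  · rintro ⟨z, hz, rfl⟩
    refine (smul_affinePoint_eq_iff (w := z)).1 ?_ |>.1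
    rw [← smul_affinePoint hz, inv_smul_smul]
  · intro hw
    refine ⟨homography g⁻¹ w, smul_affinePoint_eq_iff.1 ?_⟩
    rw [← smul_affinePoint hw, smul_inv_smul]

theorem hasDerivAt_homography {g : PSL(2, ℂ)} {z : ℂ} (hz : denomSq g z ≠ 0) :
    HasDerivAt (homography g) (denomSq g z)⁻¹ z := by
  induction g using QuotientGroup.induction_on with | H A
  rw [denomSq_mk, pow_ne_zero_iff two_ne_zero] at hz
  have hnum : HasDerivAt (fun z : ℂ => A 0 0 * z + A 0 1) (A 0 0) z := by
    simpa using ((hasDerivAt_id z).const_mul (A 0 0)).add_const (A 0 1)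
  have hdenom : HasDerivAt (fun z : ℂ => A 1 0 * z + A 1 1) (A 1 0) z := by
    simpa using ((hasDerivAt_id z).const_mul (A 1 0)).add_const (A 1 1)
  have hdet := A.2
  rw [Matrix.det_fin_two] at hdet
  rw [funext (homography_mk A), denomSq_mk]
  refine (hnum.div hdenom hz).congr_deriv ?_
  rw [inv_eq_one_div]
  congr 1
  linear_combination hdet

theorem ae_denomSq_ne_zero (g : PSL(2, ℂ)) : ∀ᵐ z : ℂ, denomSq g z ≠ 0 := by
  refine Set.Subsingleton.measure_zero (s := {z | ¬ denomSq g z ≠ 0}) (fun z hz w hw => ?_) volume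
  induction g using QuotientGroup.induction_on with | H A
  rw [Set.mem_ofPred_eq, not_not, denomSq_mk, sq_eq_zero_iff] at hz hw
  have hdet := A.2
  rw [Matrix.det_fin_two] at hdet
  linear_combination (A 0 0 * z + A 0 1) * hw - (A 0 0 * w + A 0 1) * hz - (z - w) * hdet

theorem ofReal_abs_det_smul_one (w : ℂ) :
    ENNReal.ofReal |((w • (1 : ℂ →L[ℝ] ℂ)).det)| = ‖w‖ₑ ^ 2 := by
  have hdet : (w • (1 : ℂ →L[ℝ] ℂ)).det = Complex.normSq w := by
    rw [← Algebra.norm_complex_apply, Algebra.norm_apply]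
    rfl
  rw [hdet, abs_of_nonneg (Complex.normSq_nonneg w), Complex.normSq_eq_norm_sq,
    ENNReal.ofReal_pow (norm_nonneg w), ofReal_norm]

theorem ae_areaMeasure : ae areaMeasure = ae volume :=
  Measure.ae_ennreal_smul_measure_eq two_ne_zero _

theorem lintegral_homography (g : PSL(2, ℂ)) (f : ℂ → ℝ≥0∞) :
    ∫⁻ z, f (homography g z) * ‖(denomSq g z)⁻¹‖ₑ ^ 2 ∂areaMeasure = ∫⁻ z, f z ∂areaMeasure := by
  have hmeas : MeasurableSet {z | denomSq g z ≠ 0} :=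
    (isOpen_ne_fun ((continuous_affineProd 1).comp (Continuous.prodMk_right g))
      continuous_const).measurableSet
  have huniv (g : PSL(2, ℂ)) : {z | denomSq g z ≠ 0} =ᵐ[volume] Set.univ :=
    Filter.eventuallyEq_univ.2 (ae_denomSq_ne_zero g)
  have hchange := lintegral_image_eq_lintegral_abs_det_fderiv_mul volume hmeas
    (fun z hz => (hasDerivAt_homography hz).complexToReal_fderiv.hasFDerivWithinAt)
    (injOn_homography g) f
  rw [image_homography, setLIntegral_congr (huniv g⁻¹), setLIntegral_congr (huniv g),
    setLIntegral_univ, setLIntegral_univ] at hchange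
  simp only [areaMeasure, lintegral_smul_measure, hchange, ofReal_abs_det_smul_one, mul_comm]

section Measurable

variable [MeasurableSpace PSL(2, ℂ)] [BorelSpace PSL(2, ℂ)]

theorem measurable_denomSq : Measurable fun p : PSL(2, ℂ) × ℂ => denomSq p.1 p.2 :=
  (continuous_affineProd 1).measurable

theorem measurable_homography : Measurable fun p : PSL(2, ℂ) × ℂ => homography p.1 p.2 :=
  (continuous_affineProd 0).measurable.div measurable_denomSq

instance : SigmaFinite areaMeasure :=
  inferInstanceAs (SigmaFinite ((2 : NNReal) • (volume : Measure ℂ)))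

theorem quasiMeasurePreserving_homography (g : PSL(2, ℂ)) :
    Measure.QuasiMeasurePreserving (homography g) areaMeasure areaMeasure := by
  have hmeas : Measurable (homography g) := Measurable.of_uncurry_left measurable_homography
  refine ⟨hmeas, Measure.AbsolutelyContinuous.mk fun s hs hzero => ?_⟩
  have hdenom : Measurable fun z => ‖(denomSq g z)⁻¹‖ₑ ^ 2 :=
    (Measurable.of_uncurry_left measurable_denomSq).inv.enorm.pow_const 2
  have hint : ∫⁻ z, s.indicator 1 (homography g z) * ‖(denomSq g z)⁻¹‖ₑ ^ 2 ∂areaMeasure = 0 := by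
    rw [lintegral_homography, lintegral_indicator_one hs, hzero]
  rw [Measure.map_apply hmeas hs, measure_eq_zero_iff_ae_notMem]
  have hint' := (lintegral_eq_zero_iff
    (((measurable_one.indicator hs).comp hmeas).mul hdenom)).1 hint
  filter_upwards [hint', ae_areaMeasure ▸ ae_denomSq_ne_zero g] with z hz hne hzs
  simp_all [Set.mem_preimage.1 hzs]

theorem quasiMeasurePreserving_homography_prod (μ : Measure PSL(2, ℂ)) [SFinite μ] :
    Measure.QuasiMeasurePreserving (fun p : PSL(2, ℂ) × ℂ => homography p.1 p.2)
      (μ.prod areaMeasure) areaMeasure :=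
  QuasiMeasurePreserving.prod_of_right measurable_homography
    (ae_of_all _ quasiMeasurePreserving_homography)

end Measurable

/-! ### Forms and their pull-backs in the affine coordinate -/

/-- The linear form `w ↦ w ∧ v`. -/
def wedgeCLM (v : Fin 2 → ℂ) : (Fin 2 → ℂ) →L[ℂ] ℂ :=
  v 1 • ContinuousLinearMap.proj 0 - v 0 • ContinuousLinearMap.proj 1

theorem wedgeCLM_apply (v w : Fin 2 → ℂ) : wedgeCLM v w = wedge w v := by
  simp [wedgeCLM, wedge, mul_comm]

namespace OneForm

theorem form_smul {c : ℂ} (hc : c ≠ 0) (Φ : OneForm) (v : Fin 2 → ℂ) :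
    Φ.form (c • v) = c⁻¹ • Φ.form v := by
  ext1 w
  simpa [smul_inv_smul₀ hc, form] using Φ.2.2 c hc v (c⁻¹ • w)

theorem form_eq_smul_wedgeCLM (Φ : OneForm) {v w : Fin 2 → ℂ} (h : wedge w v = 1) :
    Φ.form v = Φ.form v w • wedgeCLM v := by
  ext1 x
  have hv : Φ.form v v = 0 := Φ.2.1 v
  have hx := congrArg (Φ.form v) (wedge_smul_eq_add x w v)
  rw [map_add, map_smul, map_smul, map_smul, h, hv, one_smul, smul_zero, add_zero] at hx
  rw [smul_apply, wedgeCLM_apply, ← hx, smul_eq_mul, smul_eq_mul, mul_comm]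

theorem form_affine (Φ : OneForm) (z : ℂ) : Φ.form ![z, 1] = Φ.coeff z • wedgeCLM ![z, 1] :=
  Φ.form_eq_smul_wedgeCLM (by simp [wedge])

theorem pullback_add (g : PSL(2, ℂ)) (Φ Ψ : OneForm) :
    pullback g (Φ + Ψ) = pullback g Φ + pullback g Ψ := by
  induction g using QuotientGroup.induction_on with | H A
  rfl

theorem pullback_smul (g : PSL(2, ℂ)) (c : ℂ) (Φ : OneForm) :
    pullback g (c • Φ) = c • pullback g Φ := by
  induction g using QuotientGroup.induction_on with | H A
  rfl

theorem pullback_mk_form (A : SL(2, ℂ)) (Φ : OneForm) (v w : Fin 2 → ℂ) :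
    (pullback (QuotientGroup.mk A) Φ).form v w = Φ.form (A.1 *ᵥ v) (A.1 *ᵥ w) := rfl

theorem pullback_mul (g h : PSL(2, ℂ)) (Φ : OneForm) :
    pullback (g * h) Φ = pullback h (pullback g Φ) := by
  induction g using QuotientGroup.induction_on with | H A
  induction h using QuotientGroup.induction_on with | H B
  refine Subtype.ext (funext fun v => ContinuousLinearMap.ext fun w => ?_)
  change (pullback (QuotientGroup.mk (A * B)) Φ).form v w =
    (pullback (QuotientGroup.mk B) (pullback (QuotientGroup.mk A) Φ)).form v w
  rw [pullback_mk_form, pullback_mk_form, pullback_mk_form, Matrix.mulVec_mulVec,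
    Matrix.mulVec_mulVec, Matrix.SpecialLinearGroup.coe_mul]

theorem coeff_pullback {g : PSL(2, ℂ)} {z : ℂ} (hz : denomSq g z ≠ 0) (Φ : OneForm) :
    (pullback g Φ).coeff z = (denomSq g z)⁻¹ * Φ.coeff (homography g z) := by
  induction g using QuotientGroup.induction_on with | H A
  rw [denomSq_mk, pow_ne_zero_iff two_ne_zero] at hz
  have hmul : A.1 *ᵥ ![z, 1] = (A 1 0 * z + A 1 1) • ![homography (QuotientGroup.mk A) z, 1] := by
    ext i
    fin_cases i <;> simp [homography_mk, mul_div_cancel₀ _ hz]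
  have hwedge : wedge (A.1 *ᵥ ![1, 0]) (A.1 *ᵥ ![z, 1]) = 1 := by
    rw [wedge_mulVec]
    simp [wedge]
  rw [hmul, wedge_smul_right] at hwedge
  rw [coeff, pullback_mk_form, hmul, form_smul hz, form_affine, smul_apply, smul_apply,
    wedgeCLM_apply, denomSq_mk, eq_inv_of_mul_eq_one_right hwedge]
  simp only [smul_eq_mul, sq, mul_inv]
  ring

variable [MeasurableSpace PSL(2, ℂ)]

theorem transfer_form_apply (ν : Measure PSL(2, ℂ)) (Φ : OneForm) {v : Fin 2 → ℂ} (hv : v ≠ 0)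
    (w : Fin 2 → ℂ) : (transfer ν Φ).form v w = ∫ g, (pullback g Φ).form v w ∂ν := by
  obtain ⟨x, hx⟩ := exists_wedge_eq_one hv
  have hform (g : PSL(2, ℂ)) := form_eq_smul_wedgeCLM (pullback g Φ) hx
  calc (transfer ν Φ).form v w = (∫ g, (pullback g Φ).form v x • wedgeCLM v ∂ν) w :=
        congrArg (· w) (integral_congr_ae (ae_of_all _ hform))
    _ = ∫ g, (pullback g Φ).form v x • wedgeCLM v w ∂ν := by
        rw [integral_smul_const, integral_smul_const, smul_apply]
    _ = ∫ g, (pullback g Φ).form v w ∂ν :=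
        integral_congr_ae (ae_of_all _ fun g => congrArg (· w) (hform g).symm)

theorem coeff_transfer (ν : Measure PSL(2, ℂ)) (Φ : OneForm) (z : ℂ) :
    (transfer ν Φ).coeff z = ∫ g, (pullback g Φ).coeff z ∂ν :=
  transfer_form_apply ν Φ (fun h => by simpa using congrFun h 1) _

theorem coeff_transfer_smul (ν : Measure PSL(2, ℂ)) (c : ℂ) (Φ : OneForm) :
    (transfer ν (c • Φ)).coeff = (c • transfer ν Φ).coeff := by
  ext z
  change _ = c • (transfer ν Φ).coeff z
  simp only [coeff_transfer, pullback_smul]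
  exact integral_smul c _

end OneForm

/-! ### Energy of forms -/

section Variance

variable {α : Type*} [MeasurableSpace α]

theorem lintegral_enorm_sq {E : Type*} [NormedAddCommGroup E] (f : α → E) (m : Measure α) :
    ∫⁻ a, ‖f a‖ₑ ^ 2 ∂m = eLpNorm f 2 m ^ 2 := by
  simpa using (eLpNorm_nnreal_pow_eq_lintegral (f := f) (μ := m) (p := 2) two_ne_zero).symm

theorem lintegral_enorm_sq_eq_ofReal_integral {E : Type*} [NormedAddCommGroup E] {m : Measure α}
    {X : α → E} (hX : MemLp X 2 m) :
    ∫⁻ a, ‖X a‖ₑ ^ 2 ∂m = ENNReal.ofReal (∫ a, ‖X a‖ ^ 2 ∂m) := by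
  rw [ofReal_integral_eq_lintegral_ofReal (hX.integrable_norm_pow two_ne_zero)
    (ae_of_all _ fun a => sq_nonneg _)]
  simp only [ENNReal.ofReal_pow (norm_nonneg _), ofReal_norm]

variable {E : Type*} [NormedAddCommGroup E] [InnerProductSpace ℝ E] [CompleteSpace E]
  {m : Measure α} [IsProbabilityMeasure m] {X : α → E}

theorem integral_norm_sub_integral_sq_add (hX : MemLp X 2 m) :
    ∫ a, ‖X a - ∫ b, X b ∂m‖ ^ 2 ∂m + ‖∫ b, X b ∂m‖ ^ 2 = ∫ a, ‖X a‖ ^ 2 ∂m := by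
  set c := ∫ b, X b ∂m with hc
  have hint : Integrable (fun a => X a - c) m :=
    (hX.integrable one_le_two).sub (integrable_const c)
  have hsq : Integrable (fun a => ‖X a - c‖ ^ 2) m :=
    (hX.sub (memLp_const c)).integrable_norm_pow two_ne_zero
  have hinner : Integrable (fun a => 2 * inner ℝ (X a - c) c) m :=
    (hint.inner_const c).const_mul 2
  have horth : ∫ a, 2 * inner ℝ (X a - c) c ∂m = 0 := by
    simp only [real_inner_comm c, integral_const_mul]
    rw [integral_inner hint, integral_sub (hX.integrable one_le_two) (integrable_const c)]
    simp [hc]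
  calc ∫ a, ‖X a - c‖ ^ 2 ∂m + ‖c‖ ^ 2
      = ∫ a, (‖X a - c‖ ^ 2 + 2 * inner ℝ (X a - c) c + ‖c‖ ^ 2) ∂m := by
        rw [integral_add (by exact hsq.add hinner) (integrable_const _), integral_add hsq hinner,
          horth]
        simp
    _ = ∫ a, ‖X a‖ ^ 2 ∂m := by simp only [← norm_add_sq_real, sub_add_cancel]

theorem lintegral_enorm_sub_integral_sq_add (hX : MemLp X 2 m) :
    ∫⁻ a, ‖X a - ∫ b, X b ∂m‖ₑ ^ 2 ∂m + ‖∫ b, X b ∂m‖ₑ ^ 2 = ∫⁻ a, ‖X a‖ₑ ^ 2 ∂m := by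
  rw [lintegral_enorm_sq_eq_ofReal_integral hX,
    lintegral_enorm_sq_eq_ofReal_integral (X := fun a => X a - _) (hX.sub (memLp_const _)),
    ← ofReal_norm, ← ENNReal.ofReal_pow (norm_nonneg _),
    ← ENNReal.ofReal_add (integral_nonneg fun a => sq_nonneg _) (sq_nonneg _)]
  exact congrArg _ (integral_norm_sub_integral_sq_add hX)

end Variance

namespace OneForm

/-- The square `∫ i φ ∧ φ̄` of the `L²` norm of a form. -/
def energy (Φ : OneForm) : ℝ≥0∞ := ∫⁻ z, ‖Φ.coeff z‖ₑ ^ 2 ∂areaMeasure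

theorem energy_eq_eLpNorm_sq (Φ : OneForm) : Φ.energy = eLpNorm Φ.coeff 2 areaMeasure ^ 2 :=
  lintegral_enorm_sq _ _

theorem memL2_iff {Φ : OneForm} :
    Φ.MemL2 ↔ AEStronglyMeasurable Φ.coeff areaMeasure ∧ Φ.energy < ∞ := by
  rw [MemL2, MemLp, energy_eq_eLpNorm_sq, ENNReal.pow_lt_top_iff]
  simp

theorem lintegral_pullback (g : PSL(2, ℂ)) (Φ : OneForm) (f : ℙ ℂ (Fin 2 → ℂ) → ℝ≥0∞) :
    ∫⁻ z, f (g • affinePoint z) * ‖(pullback g Φ).coeff z‖ₑ ^ 2 ∂areaMeasure =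
      ∫⁻ z, f (affinePoint z) * ‖Φ.coeff z‖ₑ ^ 2 ∂areaMeasure := by
  rw [← lintegral_homography g fun z => f (affinePoint z) * ‖Φ.coeff z‖ₑ ^ 2]
  refine lintegral_congr_ae ?_
  filter_upwards [ae_areaMeasure ▸ ae_denomSq_ne_zero g] with z hz
  rw [coeff_pullback hz, smul_affinePoint hz, enorm_mul, mul_pow, mul_assoc,
    mul_comm (‖(denomSq g z)⁻¹‖ₑ ^ 2)]

theorem energy_pullback (g : PSL(2, ℂ)) (Φ : OneForm) : (pullback g Φ).energy = Φ.energy := by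
  simpa [energy] using lintegral_pullback g Φ 1

/-- The measure `i φ ∧ φ̄` on the projective line. -/
def massMeasure (Φ : OneForm) : Measure (ℙ ℂ (Fin 2 → ℂ)) :=
  (areaMeasure.withDensity fun z => ‖Φ.coeff z‖ₑ ^ 2).map affinePoint

theorem massMeasure_apply (Φ : OneForm) {B : Set (ℙ ℂ (Fin 2 → ℂ))} (hB : MeasurableSet B) :
    Φ.massMeasure B =
      ∫⁻ z, B.indicator 1 (affinePoint z) * ‖Φ.coeff z‖ₑ ^ 2 ∂areaMeasure := by
  have hpre : MeasurableSet (affinePoint ⁻¹' B) := continuous_affinePoint.measurable hB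
  rw [massMeasure, Measure.map_apply continuous_affinePoint.measurable hB, withDensity_apply _ hpre,
    ← lintegral_indicator hpre]
  refine lintegral_congr fun z => ?_
  by_cases hz : affinePoint z ∈ B
  · rw [Set.indicator_of_mem hz, Set.indicator_of_mem (by exact hz), Pi.one_apply, one_mul]
  · rw [Set.indicator_of_notMem hz, Set.indicator_of_notMem (by exact hz), zero_mul]

theorem massMeasure_univ (Φ : OneForm) : Φ.massMeasure Set.univ = Φ.energy := by
  simp [massMeasure_apply, energy]

theorem map_smul_massMeasure_pullback (g : PSL(2, ℂ)) (Φ : OneForm) :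
    (pullback g Φ).massMeasure.map (g • ·) = Φ.massMeasure := by
  ext B hB
  have hB' : MeasurableSet ((g • · : ℙ ℂ (Fin 2 → ℂ) → _) ⁻¹' B) := measurable_const_smul g hB
  rw [Measure.map_apply (measurable_const_smul g) hB, massMeasure_apply _ hB',
    massMeasure_apply _ hB]
  exact lintegral_pullback g Φ (B.indicator 1)

end OneForm

namespace L2Form

theorem mk_eq_mk_of_ae {Φ Ψ : OneForm} (hΦ : Φ.MemL2) (hΨ : Ψ.MemL2)
    (h : Φ.coeff =ᵐ[areaMeasure] Ψ.coeff) : mk Φ hΦ = mk Ψ hΨ := by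
  refine SeparationQuotient.mk_eq_mk.2 (Metric.inseparable_iff.2 ?_)
  change dist (MemLp.toLp Φ.coeff hΦ) (MemLp.toLp Ψ.coeff hΨ) = 0
  rw [(MemLp.toLp_eq_toLp_iff hΦ hΨ).2 h, dist_self]

theorem enorm_mk_sq {Φ : OneForm} (hΦ : Φ.MemL2) : ‖mk Φ hΦ‖ₑ ^ 2 = Φ.energy := by
  rw [Φ.energy_eq_eLpNorm_sq, ← Lp.enorm_toLp hΦ]
  rfl

end L2Form

/-! ### The transfer operator -/

section Transfer

variable [MeasurableSpace PSL(2, ℂ)] [BorelSpace PSL(2, ℂ)]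

namespace OneForm

theorem aestronglyMeasurable_pullback (ν : Measure PSL(2, ℂ)) [SFinite ν] {Φ : OneForm}
    (hΦ : AEStronglyMeasurable Φ.coeff areaMeasure) :
    AEStronglyMeasurable (fun p : PSL(2, ℂ) × ℂ => (pullback p.1 Φ).coeff p.2)
      (ν.prod areaMeasure) := by
  have hne : MeasurableSet {p : PSL(2, ℂ) × ℂ | denomSq p.1 p.2 ≠ 0} :=
    measurable_denomSq (measurableSet_singleton 0).compl
  have hae : ∀ᵐ p ∂ν.prod areaMeasure, denomSq p.1 p.2 ≠ 0 :=
    (Measure.ae_prod_mem_iff_ae_ae_mem hne).2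
      (ae_of_all _ fun g => ae_areaMeasure ▸ ae_denomSq_ne_zero g)
  refine (measurable_denomSq.inv.aestronglyMeasurable.mul
    (hΦ.comp_quasiMeasurePreserving (quasiMeasurePreserving_homography_prod ν))).congr ?_
  filter_upwards [hae] with p hp
  exact (coeff_pullback hp Φ).symm

variable (ν : Measure PSL(2, ℂ)) [IsProbabilityMeasure ν] {Φ Ψ : OneForm}

theorem lintegral_lintegral_pullback (hΦ : AEStronglyMeasurable Φ.coeff areaMeasure) :
    ∫⁻ z, ∫⁻ g, ‖(pullback g Φ).coeff z‖ₑ ^ 2 ∂ν ∂areaMeasure = Φ.energy := by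
  rw [lintegral_lintegral_swap
    ((aestronglyMeasurable_pullback ν hΦ).prod_swap.enorm.pow_const 2)]
  calc ∫⁻ g, (pullback g Φ).energy ∂ν = Φ.energy := by simp [energy_pullback]

theorem ae_memLp_pullback (hΦ : Φ.MemL2) :
    ∀ᵐ z ∂areaMeasure, MemLp (fun g => (pullback g Φ).coeff z) 2 ν := by
  have hmeas := (aestronglyMeasurable_pullback ν hΦ.1).prod_swap
  have hfin : ∀ᵐ z ∂areaMeasure, ∫⁻ g, ‖(pullback g Φ).coeff z‖ₑ ^ 2 ∂ν < ∞ := by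
    refine ae_lt_top' (hmeas.enorm.pow_const 2).lintegral_prod_right' ?_
    exact (lintegral_lintegral_pullback ν hΦ.1).trans_ne (memL2_iff.1 hΦ).2.ne
  filter_upwards [hfin, hmeas.prodMk_left] with z hz hmeasz
  rw [lintegral_enorm_sq] at hz
  exact ⟨hmeasz, by simpa [ENNReal.pow_lt_top_iff] using hz⟩

theorem ae_integrable_coeff_pullback (hΦ : Φ.MemL2) :
    ∀ᵐ z ∂areaMeasure, Integrable (fun g => (pullback g Φ).coeff z) ν :=
  (ae_memLp_pullback ν hΦ).mono fun _ hz => hz.integrable one_le_two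

theorem ae_integrable_form_pullback (hΦ : Φ.MemL2) :
    ∀ᵐ z ∂areaMeasure, Integrable (fun g => (pullback g Φ).form ![z, 1]) ν := by
  filter_upwards [ae_integrable_coeff_pullback ν hΦ] with z hz
  simpa only [form_affine] using hz.smul_const (wedgeCLM ![z, 1])

theorem aestronglyMeasurable_transfer (hΦ : AEStronglyMeasurable Φ.coeff areaMeasure) :
    AEStronglyMeasurable (transfer ν Φ).coeff areaMeasure := by
  rw [funext (coeff_transfer ν Φ)]
  exact (aestronglyMeasurable_pullback ν hΦ).prod_swap.integral_prod_right'

/-- Integrate the bias-variance decomposition of `g ↦ g^*φ` over the projective line. -/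
theorem lintegral_energy_sub_add_energy_transfer (hΦ : Φ.MemL2) :
    ∫⁻ g, (pullback g Φ - transfer ν Φ).energy ∂ν + (transfer ν Φ).energy = Φ.energy := by
  have hT := aestronglyMeasurable_transfer ν hΦ.1
  have hdiff := ((aestronglyMeasurable_pullback ν hΦ.1).sub hT.comp_snd).enorm.pow_const 2
  calc ∫⁻ g, (pullback g Φ - transfer ν Φ).energy ∂ν + (transfer ν Φ).energy
      = ∫⁻ z, (∫⁻ g, ‖(pullback g Φ).coeff z - (transfer ν Φ).coeff z‖ₑ ^ 2 ∂ν +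
          ‖(transfer ν Φ).coeff z‖ₑ ^ 2) ∂areaMeasure := by
        rw [lintegral_add_right' _ (hT.enorm.pow_const 2), ← lintegral_lintegral_swap hdiff]
        rfl
    _ = ∫⁻ z, ∫⁻ g, ‖(pullback g Φ).coeff z‖ₑ ^ 2 ∂ν ∂areaMeasure := by
        refine lintegral_congr_ae ?_
        filter_upwards [ae_memLp_pullback ν hΦ] with z hz
        rw [coeff_transfer, lintegral_enorm_sub_integral_sq_add hz]
    _ = Φ.energy := lintegral_lintegral_pullback ν hΦ.1

theorem energy_transfer_le (hΦ : Φ.MemL2) : (transfer ν Φ).energy ≤ Φ.energy :=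
  le_add_self.trans_eq (lintegral_energy_sub_add_energy_transfer ν hΦ)

theorem MemL2.transfer (hΦ : Φ.MemL2) : (transfer ν Φ).MemL2 :=
  memL2_iff.2 ⟨aestronglyMeasurable_transfer ν hΦ.1,
    (energy_transfer_le ν hΦ).trans_lt (memL2_iff.1 hΦ).2⟩

theorem coeff_transfer_add (hΦ : Φ.MemL2) (hΨ : Ψ.MemL2) :
    (transfer ν (Φ + Ψ)).coeff =ᵐ[areaMeasure] (transfer ν Φ + transfer ν Ψ).coeff := by
  filter_upwards [ae_integrable_coeff_pullback ν hΦ, ae_integrable_coeff_pullback ν hΨ]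
    with z hz hz'
  change _ = (transfer ν Φ).coeff z + (transfer ν Ψ).coeff z
  simp only [coeff_transfer, pullback_add]
  exact integral_add hz hz'

theorem coeff_transfer_mconv (μ : Measure PSL(2, ℂ)) [IsProbabilityMeasure μ] (hΦ : Φ.MemL2) :
    (transfer (μ.mconv ν) Φ).coeff =ᵐ[areaMeasure] (transfer ν (transfer μ Φ)).coeff := by
  filter_upwards [ae_integrable_coeff_pullback (μ.mconv ν) hΦ] with z hz
  have hprod : Integrable (fun p : PSL(2, ℂ) × PSL(2, ℂ) => (pullback (p.1 * p.2) Φ).coeff z)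
      (μ.prod ν) := hz.comp_measurable (measurable_mul (M := PSL(2, ℂ)))
  rw [coeff_transfer, coeff_transfer, Measure.mconv,
    integral_map measurable_mul.aemeasurable hz.aestronglyMeasurable, integral_prod_symm _ hprod]
  refine integral_congr_ae (ae_of_all _ fun h => ?_)
  induction h using QuotientGroup.induction_on with | H B
  have hB : B.1 *ᵥ ![z, 1] ≠ 0 := mulVec_ne_zero B fun h => by simpa using congrFun h 1
  simp only [pullback_mul]
  exact (transfer_form_apply μ Φ hB _).symm

end OneForm

variable (ν : Measure PSL(2, ℂ)) [IsProbabilityMeasure ν]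

/-- The linear map `φ ↦ f_ν^* φ` on representatives. -/
def transferLinearMap : PreL2Form →ₗ[ℂ] L2Form where
  toFun Φ := L2Form.mk (OneForm.transfer ν Φ.1) (OneForm.MemL2.transfer ν Φ.2)
  map_add' Φ Ψ := L2Form.mk_eq_mk_of_ae (OneForm.MemL2.transfer ν (Φ + Ψ).2)
    (l2FormSubmodule.add_mem (OneForm.MemL2.transfer ν Φ.2) (OneForm.MemL2.transfer ν Ψ.2))
    (OneForm.coeff_transfer_add ν Φ.2 Ψ.2)
  map_smul' c Φ := L2Form.mk_eq_mk_of_ae (OneForm.MemL2.transfer ν (c • Φ).2)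
    (l2FormSubmodule.smul_mem c (OneForm.MemL2.transfer ν Φ.2))
    (Filter.EventuallyEq.of_eq (OneForm.coeff_transfer_smul ν c Φ.1))

theorem norm_transferLinearMap_le (Φ : PreL2Form) : ‖transferLinearMap ν Φ‖ ≤ 1 * ‖Φ‖ := by
  rw [one_mul, ← enorm_le_iff_norm_le, ← ENNReal.pow_le_pow_left_iff two_ne_zero]
  exact (L2Form.enorm_mk_sq _).trans_le
    ((OneForm.energy_transfer_le ν Φ.2).trans_eq (L2Form.enorm_mk_sq Φ.2).symm)

/-- The operator `f_ν^*` on `L²_{(1,0)}`. -/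
def transferCLM : L2Form →L[ℂ] L2Form :=
  SeparationQuotient.liftCLM ((transferLinearMap ν).mkContinuous 1 (norm_transferLinearMap_le ν))
    fun _ _ h => (h.map ((transferLinearMap ν).mkContinuous 1 _).continuous).eq

theorem transferCLM_mk {Φ : OneForm} (hΦ : Φ.MemL2) :
    transferCLM ν (L2Form.mk Φ hΦ) = L2Form.mk (Φ.transfer ν) (hΦ.transfer ν) := rfl

theorem isTransferOperator_transferCLM : IsTransferOperator ν (transferCLM ν) := fun _ hΦ =>
  ⟨ae_areaMeasure ▸ OneForm.ae_integrable_form_pullback ν hΦ, hΦ.transfer ν, transferCLM_mk ν hΦ⟩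

end Transfer

/-! ### Almost invariant sequences of forms -/

section AlmostInvariant

open Filter Topology BoundedContinuousFunction

theorem tendsto_eLpNorm_sq_of_tendsto_eLpNorm_sub {α ι E : Type*} [MeasurableSpace α]
    [NormedAddCommGroup E] {m : Measure α} {l : Filter ι} {u v : ι → α → E} {b : ℝ≥0∞}
    (hu : ∀ i, AEStronglyMeasurable (u i) m) (hv : ∀ i, AEStronglyMeasurable (v i) m)
    (hlim : Tendsto (fun i => eLpNorm (u i) 2 m ^ 2) l (𝓝 b))
    (hsub : Tendsto (fun i => eLpNorm (v i - u i) 2 m ^ 2) l (𝓝 0)) :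
    Tendsto (fun i => eLpNorm (v i) 2 m ^ 2) l (𝓝 b) := by
  have hsqrt : ∀ x : ℝ≥0∞, (x ^ 2) ^ (2⁻¹ : ℝ) = x := fun x => by
    simp [← ENNReal.rpow_natCast_mul]
  have hsq : ∀ x : ℝ≥0∞, (x ^ (2⁻¹ : ℝ)) ^ 2 = x := fun x => by
    simp [← ENNReal.rpow_mul_natCast]
  have hlim' := hlim.ennrpow_const 2⁻¹
  have hsub' := hsub.ennrpow_const 2⁻¹
  simp only [hsqrt, ENNReal.zero_rpow_of_pos (inv_pos.2 two_pos)] at hlim' hsub'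
  have hv' : Tendsto (fun i => eLpNorm (v i) 2 m) l (𝓝 (b ^ (2⁻¹ : ℝ))) := by
    refine tendsto_of_tendsto_of_tendsto_of_le_of_le
      (by simpa using ENNReal.Tendsto.sub hlim' hsub' (.inr ENNReal.zero_ne_top))
      (by simpa using hlim'.add hsub') (fun i => tsub_le_iff_right.2 ?_) fun i => ?_
    · simpa using eLpNorm_sub_le (hv i) ((hv i).sub (hu i)) one_le_two
    · simpa using eLpNorm_add_le (hu i) ((hv i).sub (hu i)) one_le_two
  simpa only [hsq] using ENNReal.Tendsto.pow (n := 2) hv'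

namespace OneForm

theorem lintegral_massMeasure {Φ : OneForm} (hΦ : AEStronglyMeasurable Φ.coeff areaMeasure)
    {f : ℙ ℂ (Fin 2 → ℂ) → ℝ≥0∞} (hf : Measurable f) :
    ∫⁻ x, f x ∂Φ.massMeasure =
      eLpNorm Φ.coeff 2 (areaMeasure.withDensity fun z => f (affinePoint z)) ^ 2 := by
  have hΦ2 : AEMeasurable (fun z => ‖Φ.coeff z‖ₑ ^ 2) areaMeasure := hΦ.enorm.pow_const 2
  have hfA : Measurable fun z => f (affinePoint z) := hf.comp continuous_affinePoint.measurable
  rw [← lintegral_enorm_sq, massMeasure, lintegral_map hf continuous_affinePoint.measurable,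
    lintegral_withDensity_eq_lintegral_mul₀ hΦ2 hfA.aemeasurable,
    lintegral_withDensity_eq_lintegral_mul₀ hfA.aemeasurable hΦ2]
  simp only [Pi.mul_apply, mul_comm]

theorem isFiniteMeasure_massMeasure {Φ : OneForm} (hΦ : Φ.MemL2) :
    IsFiniteMeasure Φ.massMeasure :=
  ⟨by rw [massMeasure_univ]; exact (memL2_iff.1 hΦ).2⟩

/-- The measure `i φ ∧ φ̄` of a square integrable form, as a point of the space of finite measures
with its weak topology. -/
def MemL2.massMeasure {Φ : OneForm} (hΦ : Φ.MemL2) : FiniteMeasure (ℙ ℂ (Fin 2 → ℂ)) :=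
  ⟨Φ.massMeasure, isFiniteMeasure_massMeasure hΦ⟩

theorem MemL2.ennreal_mass_massMeasure {Φ : OneForm} (hΦ : Φ.MemL2) :
    (hΦ.massMeasure.mass : ℝ≥0∞) = Φ.energy :=
  FiniteMeasure.ennreal_mass.trans Φ.massMeasure_univ

theorem MemL2.pullback {Φ : OneForm} (hΦ : Φ.MemL2) (g : PSL(2, ℂ)) : (pullback g Φ).MemL2 := by
  refine memL2_iff.2 ⟨?_, (energy_pullback g Φ).trans_lt (memL2_iff.1 hΦ).2⟩
  borelize PSL(2, ℂ)
  have hmeas : Measurable (denomSq g) := Measurable.of_uncurry_left measurable_denomSq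
  refine (hmeas.inv.aestronglyMeasurable.mul
    (hΦ.1.comp_quasiMeasurePreserving (quasiMeasurePreserving_homography g))).congr ?_
  filter_upwards [ae_areaMeasure ▸ ae_denomSq_ne_zero g] with z hz
  exact (coeff_pullback hz Φ).symm

theorem tendsto_massMeasure_of_tendsto_energy_sub {ι : Type*} {l : Filter ι}
    {Φ Ψ : ι → OneForm} (hΦ : ∀ i, (Φ i).MemL2) (hΨ : ∀ i, (Ψ i).MemL2)
    {P : FiniteMeasure (ℙ ℂ (Fin 2 → ℂ))} (hP : Tendsto (fun i => (hΦ i).massMeasure) l (𝓝 P))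
    (hsub : Tendsto (fun i => (Ψ i - Φ i).energy) l (𝓝 0)) :
    Tendsto (fun i => (hΨ i).massMeasure) l (𝓝 P) := by
  rw [FiniteMeasure.tendsto_iff_forall_lintegral_tendsto] at hP ⊢
  intro f
  have hf : Measurable fun x => (f x : ℝ≥0∞) := by fun_prop
  set m := areaMeasure.withDensity fun z => (f (affinePoint z) : ℝ≥0∞)
  have hL {Θ : OneForm} (hΘ : Θ.MemL2) :
      ∫⁻ x, f x ∂Θ.massMeasure = eLpNorm Θ.coeff 2 m ^ 2 := lintegral_massMeasure hΘ.1 hf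
  have hmeas {Θ : OneForm} (hΘ : Θ.MemL2) : AEStronglyMeasurable Θ.coeff m :=
    hΘ.1.mono_ac (withDensity_absolutelyContinuous _ _)
  have hdiff : Tendsto (fun i => eLpNorm ((Ψ i).coeff - (Φ i).coeff) 2 m ^ 2) l (𝓝 0) := by
    have hbound : Tendsto (fun i => (nndist f 0 : ℝ≥0∞) * (Ψ i - Φ i).energy) l (𝓝 0) := by
      simpa only [mul_zero] using ENNReal.Tendsto.const_mul hsub (.inr ENNReal.coe_ne_top)
    refine tendsto_of_tendsto_of_tendsto_of_le_of_le tendsto_const_nhds hbound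
      (fun _ => zero_le) fun i => ?_
    calc eLpNorm (Ψ i - Φ i).coeff 2 m ^ 2
        = ∫⁻ x, f x ∂(Ψ i - Φ i).massMeasure :=
          (hL (l2FormSubmodule.sub_mem (hΨ i) (hΦ i))).symm
      _ ≤ ∫⁻ _, nndist f 0 ∂(Ψ i - Φ i).massMeasure :=
          lintegral_mono fun x => ENNReal.coe_le_coe.2 (NNReal.upper_bound f x)
      _ = nndist f 0 * (Ψ i - Φ i).energy := by rw [lintegral_const, massMeasure_univ]
  have hlimΦ : Tendsto (fun i => eLpNorm (Φ i).coeff 2 m ^ 2) l (𝓝 (∫⁻ x, f x ∂P)) :=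
    (hP f).congr fun i => hL (hΦ i)
  exact (tendsto_eLpNorm_sq_of_tendsto_eLpNorm_sub (fun i => hmeas (hΦ i))
    (fun i => hmeas (hΨ i)) hlimΦ hdiff).congr fun i => (hL (hΨ i)).symm

/-- The measures `i φ ∧ φ̄` have weak limits by compactness, and these inherit the equivariance. -/
theorem isElementary_of_tendsto_energy {S : Set PSL(2, ℂ)} {φ : ℕ → ℕ → OneForm}
    (hφ : ∀ n N, (φ n N).MemL2) (h1 : ∀ n N, (φ n N).energy ≤ 1)
    (hlim : ∀ N, Tendsto (fun n => (φ n N).energy) atTop (𝓝 1))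
    (hS : ∀ g ∈ S, ∀ N,
      Tendsto (fun n => (pullback g (φ n N) - φ n (N + 1)).energy) atTop (𝓝 0)) :
    IsElementary S := by
  set U : Ultrafilter ℕ := hyperfilter ℕ
  have hU : (U : Filter ℕ) ≤ atTop := Nat.hyperfilter_le_atTop
  have hlimit : ∀ N, ∃ P : FiniteMeasure (ℙ ℂ (Fin 2 → ℂ)),
      Tendsto (fun n => (hφ n N).massMeasure) U (𝓝 P) := fun N => by
    have hcompact := isCompact_setOfPred_finiteMeasure_le_of_compactSpace (ℙ ℂ (Fin 2 → ℂ)) 1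
    obtain ⟨P, -, hP⟩ := hcompact.ultrafilter_le_nhds (U.map fun n => (hφ n N).massMeasure) <|
      le_principal_iff.2 <| mem_map.2 <| univ_mem' fun n =>
        ENNReal.coe_le_coe.1 ((hφ n N).ennreal_mass_massMeasure.trans_le (h1 n N))
    exact ⟨P, hP⟩
  choose P hP using hlimit
  have hprob : ∀ N, IsProbabilityMeasure (P N : Measure (ℙ ℂ (Fin 2 → ℂ))) := fun N => by
    have hmass : Tendsto (fun n => (φ n N).energy) U (𝓝 (P N).mass) :=
      (ENNReal.tendsto_coe.2 (hP N).mass).congr fun n => (hφ n N).ennreal_mass_massMeasure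
    refine ⟨?_⟩
    rw [← FiniteMeasure.ennreal_mass]
    exact tendsto_nhds_unique hmass ((hlim N).mono_left hU)
  refine isElementary_of_forall_map_smul_eq (M := fun N => P N) fun g hg N => ?_
  have hpull : Tendsto (fun n => ((hφ n N).pullback g).massMeasure) U (𝓝 (P (N + 1))) :=
    tendsto_massMeasure_of_tendsto_energy_sub _ _ (hP (N + 1)) ((hS g hg N).mono_left hU)
  have hmap := FiniteMeasure.tendsto_map_of_tendsto_of_continuous _ _ hpull
    (continuous_const_smul g)
  have heq : ∀ n, ((hφ n N).pullback g).massMeasure.map (g • ·) = (hφ n N).massMeasure :=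
    fun n => FiniteMeasure.toMeasure_injective (map_smul_massMeasure_pullback g (φ n N))
  simp only [heq] at hmap
  exact congrArg FiniteMeasure.toMeasure (tendsto_nhds_unique hmap (hP N))

end OneForm

end AlmostInvariant

/-! ### Convolution powers -/

section ConvolutionPowers

open Filter Topology

theorem ae_tendsto_zero_of_tsum_lintegral_ne_top {α : Type*} [MeasurableSpace α] {m : Measure α}
    {f : ℕ → α → ℝ≥0∞} (hf : ∀ n, AEMeasurable (f n) m) (hsum : ∑' n, ∫⁻ a, f n a ∂m ≠ ∞) :
    ∀ᵐ a ∂m, Tendsto (fun n => f n a) atTop (𝓝 0) := by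
  rw [← lintegral_tsum hf] at hsum
  filter_upwards [ae_lt_top' (AEMeasurable.tsum hf) hsum] with a ha
  exact ENNReal.tendsto_atTop_zero_of_tsum_ne_top ha.ne

variable [MeasurableSpace PSL(2, ℂ)] [BorelSpace PSL(2, ℂ)]
  (μ : Measure PSL(2, ℂ)) [IsProbabilityMeasure μ]

theorem isProbabilityMeasure_convPow (n : ℕ) : IsProbabilityMeasure (convPow μ n) := by
  induction n with
  | zero => exact Measure.dirac.isProbabilityMeasure
  | succ n ih => exact Measure.isProbabilityMeasure_map measurable_mul.aemeasurable

namespace OneForm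

theorem MemL2.iterate_transfer {Φ : OneForm} (hΦ : Φ.MemL2) (N : ℕ) :
    ((OneForm.transfer μ)^[N] Φ).MemL2 :=
  Function.Iterate.rec MemL2 hΦ (fun _ hΨ => hΨ.transfer μ) N

theorem coeff_transfer_convPow (n : ℕ) {Φ : OneForm} (hΦ : Φ.MemL2) :
    (Φ.transfer (convPow μ (n + 1))).coeff =ᵐ[areaMeasure] ((transfer μ)^[n + 1] Φ).coeff := by
  induction n generalizing Φ with
  | zero => rw [show convPow μ (0 + 1) = μ from Measure.mconv_dirac_one μ]; rfl
  | succ n ih =>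
    have := isProbabilityMeasure_convPow μ (n + 1)
    exact (coeff_transfer_mconv (convPow μ (n + 1)) μ hΦ).trans (ih (hΦ.transfer μ))

theorem antitone_energy_iterate_transfer {Φ : OneForm} (hΦ : Φ.MemL2) :
    Antitone fun N => ((transfer μ)^[N] Φ).energy :=
  antitone_nat_of_succ_le fun N => by
    rw [Function.iterate_succ_apply']
    exact energy_transfer_le μ (hΦ.iterate_transfer μ N)

theorem energy_transfer_convPow (n : ℕ) {Φ : OneForm} (hΦ : Φ.MemL2) :
    (Φ.transfer (convPow μ (n + 1))).energy = ((transfer μ)^[n + 1] Φ).energy :=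
  lintegral_congr_ae ((coeff_transfer_convPow μ n hΦ).mono fun z hz => by simp only [hz])

end OneForm

open OneForm

theorem exists_lt_energy_transfer {c : ℝ≥0∞} (hc : c < 1) (hμ : 1 ≤ ‖transferCLM μ‖) :
    ∃ Φ : OneForm, Φ.MemL2 ∧ Φ.energy ≤ 1 ∧ c < (transfer μ Φ).energy := by
  lift c to NNReal using hc.ne_top
  have sqrt_lt {r : NNReal} : NNReal.sqrt c < r ↔ c < r ^ 2 :=
    lt_iff_lt_of_le_iff_le NNReal.le_sqrt_iff_sq_le
  have hsqrt : NNReal.sqrt c < ‖transferCLM μ‖₊ :=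
    lt_of_lt_of_le (sqrt_lt.2 (by rwa [one_pow, ← ENNReal.coe_lt_one_iff])) hμ
  obtain ⟨x, hx, hTx⟩ := (transferCLM μ).exists_lt_apply_of_lt_opNNNorm hsqrt
  obtain ⟨⟨Φ, hΦ⟩, rfl⟩ := SeparationQuotient.surjective_mk x
  change ‖L2Form.mk Φ hΦ‖₊ < 1 at hx
  refine ⟨Φ, hΦ, ?_, ?_⟩
  · rw [← L2Form.enorm_mk_sq hΦ]
    exact pow_le_one₀ zero_le (ENNReal.coe_le_one_iff.2 hx.le)
  · rw [← L2Form.enorm_mk_sq (hΦ.transfer μ), ← transferCLM_mk μ hΦ]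
    exact ENNReal.coe_lt_coe.2 (sqrt_lt.1 hTx)

theorem aemeasurable_energy_pullback_sub {Φ Ψ : OneForm}
    (hΦ : AEStronglyMeasurable Φ.coeff areaMeasure)
    (hΨ : AEStronglyMeasurable Ψ.coeff areaMeasure) :
    AEMeasurable (fun g => (pullback g Φ - Ψ).energy) μ :=
  (((aestronglyMeasurable_pullback μ hΦ).sub hΨ.comp_snd).enorm.pow_const 2).lintegral_prod_right'

theorem lintegral_energy_pullback_sub_iterate_le {Φ : OneForm} {ε : ℝ≥0∞} {n : ℕ} (hΦ : Φ.MemL2)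
    (h1 : Φ.energy ≤ 1) (h : 1 ≤ ((transfer μ)^[n + 1] Φ).energy + ε) {N : ℕ} (hN : N ≤ n) :
    ∫⁻ g, (pullback g ((transfer μ)^[N] Φ) - (transfer μ)^[N + 1] Φ).energy ∂μ ≤ ε := by
  have hanti := antitone_energy_iterate_transfer μ hΦ
  have hfin : ((transfer μ)^[N + 1] Φ).energy ≠ ∞ :=
    (memL2_iff.1 (hΦ.iterate_transfer μ (N + 1))).2.ne
  refine (ENNReal.add_le_add_iff_right hfin).1 ?_
  calc ∫⁻ g, (pullback g ((transfer μ)^[N] Φ) - (transfer μ)^[N + 1] Φ).energy ∂μ +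
        ((transfer μ)^[N + 1] Φ).energy
      = ((transfer μ)^[N] Φ).energy := by
        rw [Function.iterate_succ_apply']
        exact lintegral_energy_sub_add_energy_transfer μ (hΦ.iterate_transfer μ N)
    _ ≤ 1 := (hanti N.zero_le).trans h1
    _ ≤ ((transfer μ)^[n + 1] Φ).energy + ε := h
    _ ≤ ε + ((transfer μ)^[N + 1] Φ).energy := by
        rw [add_comm]
        exact add_le_add_right (hanti (by omega)) ε

theorem isElementary_support_of_tsum_ne_top {Φ : ℕ → OneForm} {ε : ℕ → ℝ≥0∞}
    (hΦ : ∀ n, (Φ n).MemL2) (h1 : ∀ n, (Φ n).energy ≤ 1) (hε : ∑' n, ε n ≠ ∞)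
    (h : ∀ n, 1 ≤ ((transfer μ)^[n + 1] (Φ n)).energy + ε n) :
    IsElementary μ.support := by
  let φ : ℕ → ℕ → OneForm := fun n N => (transfer μ)^[N] (Φ n)
  have hφ : ∀ n N, (φ n N).MemL2 := fun n N => (hΦ n).iterate_transfer μ N
  have hanti : ∀ n, Antitone fun N => (φ n N).energy := fun n =>
    antitone_energy_iterate_transfer μ (hΦ n)
  have hφ1 : ∀ n N, (φ n N).energy ≤ 1 := fun n N => (hanti n N.zero_le).trans (h1 n)
  have hlim : ∀ N, Tendsto (fun n => (φ n N).energy) atTop (𝓝 1) := fun N => by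
    have hε0 : Tendsto (fun n => 1 - ε n) atTop (𝓝 (1 - 0)) :=
      ENNReal.Tendsto.sub tendsto_const_nhds (ENNReal.tendsto_atTop_zero_of_tsum_ne_top hε)
        (.inl ENNReal.one_ne_top)
    rw [tsub_zero] at hε0
    refine tendsto_of_tendsto_of_tendsto_of_le_of_le' hε0 tendsto_const_nhds ?_
      (.of_forall fun n => hφ1 n N)
    filter_upwards [eventually_ge_atTop N] with n hn
    exact (tsub_le_iff_right.2 (h n)).trans (hanti n (by omega))
  let S : Set PSL(2, ℂ) := {g | ∀ N,
    Tendsto (fun n => (pullback g (φ n N) - φ n (N + 1)).energy) atTop (𝓝 0)}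
  have hS : ∀ᵐ g ∂μ, g ∈ S := ae_all_iff.2 fun N => by
    have hsum : ∑' n, ∫⁻ g, (pullback g (φ (n + N) N) - φ (n + N) (N + 1)).energy ∂μ ≠ ∞ := by
      refine ne_top_of_le_ne_top hε (le_trans (ENNReal.tsum_le_tsum fun n => ?_)
        (ENNReal.tsum_comp_le_tsum_of_injective (add_left_injective N) ε))
      exact lintegral_energy_pullback_sub_iterate_le μ (hΦ _) (h1 _) (h _) (Nat.le_add_left N n)
    filter_upwards [ae_tendsto_zero_of_tsum_lintegral_ne_top (fun n =>
      aemeasurable_energy_pullback_sub μ (hφ (n + N) N).1 (hφ (n + N) (N + 1)).1) hsum] with g hg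
    exact (tendsto_add_atTop_iff_nat N).1 hg
  have hSelem : IsElementary S := isElementary_of_tendsto_energy hφ hφ1 hlim fun g hg => hg
  exact hSelem.of_subset_closure
    (Measure.support_subset_of_isClosed isClosed_closure (mem_of_superset hS subset_closure))

end ConvolutionPowers

end

theorem mainTheorem2 [MeasurableSpace PSL(2, ℂ)] [BorelSpace PSL(2, ℂ)]
    (μ : Measure PSL(2, ℂ)) [IsProbabilityMeasure μ] (hμ : ¬ IsElementary μ.support) :
    ∃ N : ℕ, 1 ≤ N ∧ ∃ T : L2Form →L[ℂ] L2Form,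
      IsTransferOperator (convPow μ N) T ∧ ‖T‖ < 1 := by
  by_contra! hnorm
  have hprob := isProbabilityMeasure_convPow μ
  have hε : ∀ n : ℕ, (1 : ℝ≥0∞) - 2⁻¹ ^ n < 1 := fun n =>
    ENNReal.sub_lt_self ENNReal.one_ne_top one_ne_zero (by simp)
  choose Φ hΦ hΦ1 hlt using fun n : ℕ => exists_lt_energy_transfer (convPow μ (n + 1)) (hε n)
    (hnorm (n + 1) n.succ_pos _ (isTransferOperator_transferCLM _))
  refine hμ (isElementary_support_of_tsum_ne_top μ (ε := fun n => 2⁻¹ ^ n) hΦ hΦ1 ?_ fun n => ?_)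
  · simp [ENNReal.tsum_geometric]
  · rw [← OneForm.energy_transfer_convPow μ n (hΦ n)]
    exact tsub_le_iff_right.1 (hlt n).le
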